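/- Setting. Let $(\Omega,\mathcal F)$ be a measurable space. $C_{l,Lip}(\mathbb R^n)$ is the class of $\varphi:\mathbb R^n\to\mathbb R$ with $|\varphi(x)-\varphi(y)|\le C(1+|x|^m+|y|^m)|x-y|$ for some $C>0$, $m\in\mathbb N$. Let $\mathscr H$ be a linear space of real random variables on $(\Omega,\mathcal F)$ such that $\varphi(X_1,\dots,X_n)\in\mathscr H$ whenever $X_i\in\mathscr H$ and $\varphi\in C_{l,Lip}(\mathbb R^n)$, and let $\mathbb E:\mathscr H\to[-\infty,\infty]$ be a sub-linear expectation: it is monotone, $\mathbb E[c]=c$ for constants, $\mathbb E[X+Y]\le\mathbb E[X]+\mathbb E[Y]$ whenever the right side is not of the form $\infty-\infty$, and $\mathbb E[\lambda X]=\lambda\mathbb E[X]$ for $\lambda\ge0$. Put $\mathcal E[X]=-\mathbb E[-X]$. Random vectors $X,Y$ with components in $\mathscr H$ are identically distributed if $\mathbb E[\varphi(X)]=\mathbb E[\varphi(Y)]$ for all $\varphi\in C_{l,Lip}$ for which both are finite. $Y$ is independent to $X$ if $\mathbb E[\varphi(X,Y)]=\mathbb E\big[\mathbb E[\varphi(x,Y)]|_{x=X}\big]$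 for all $\varphi\in C_{l,Lip}$ such that $\overline\varphi(x):=\mathbb E[|\varphi(x,Y)|]<\infty$ for all $x$, $\mathbb E[|\overline\varphi(X)|]<\infty$, and the random variables $\overline\varphi(X)$ and $\mathbb E[\varphi(x,Y)]|_{x=X}$ belong to $\mathscr H$. $Y$ is negatively dependent to $X$ if $\mathbb E[\varphi_1(X)\varphi_2(Y)]\le\mathbb E[\varphi_1(X)]\,\mathbb E[\varphi_2(Y)]$ for all $\varphi_1,\varphi_2\in C_{l,Lip}$, both coordinatewise nondecreasing or both coordinatewise nonincreasing, with $\varphi_1(X)\ge0$, $\mathbb E[\varphi_2(Y)]\ge0$ and $\mathbb E[|\varphi_1(X)\varphi_2(Y)|]$, $\mathbb E[|\varphi_1(X)|]$, $\mathbb E[|\varphi_2(Y)|]$ finite. A sequence $X_1,X_2,\dots$ in $\mathscr H$ is independent (negatively dependent) if $X_{i+1}$ is independent (negatively dependent) to $(X_1,\dots,X_i)$ for each $i\ge1$, and identically distributed if each $X_i$ is distributed as $X_1$. For $A\in\mathcal F$ let $\mathbb V(A)=\inf\{\mathbb E[\xi]: I_A\le\xi\in\mathscr H\}$ and $\mathbb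 V^*(A)=\inf\{\sum_{n\ge1}\mathbb V(A_n): A\subset\bigcup_n A_n,\ A_n\in\mathcal F\}$, and let $C_{\mathbb V}[X]=\int_0^\infty\mathbb V(X\ge t)\,dt+\int_{-\infty}^0[\mathbb V(X\ge t)-1]\,dt$. $\mathbb V^*$ is continuous if $\mathbb V^*(A_n)\to\mathbb V^*(A)$ whenever $A_n\uparrow A$ or $A_n\downarrow A$ in $\mathcal F$. $\mathbb E$ is countably sub-additive if $\mathbb E[X]\le\sum_{n}\mathbb E[X_n]$ whenever $X\le\sum_nX_n$ with $0\le X,X_n\in\mathscr H$. Theorem. Let $X_1,X_2,\dots\in\mathscr H$ be identically distributed and $S_n=\sum_{k=1}^nX_k$. (a) If $X_1,X_2,\dots$ are negatively dependent, $C_{\mathbb V}[|X_1|]<\infty$ and $\lim_{c\to\infty}\mathbb E[(|X_1|-c)^+]=0$, then $$\mathbb V^*\Big(\Big\{\liminf_{n\to\infty}\frac{S_n}n<\mathcal E[X_1]\Big\}\cup\Big\{\limsup_{n\to\infty}\frac{S_n}n>\mathbb E[X_1]\Big\}\Big)=0.$$ (b) If $X_1,X_2,\dots$ are independent, $\mathbb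 V^*$ is continuous, $\mathbb E$ is countably sub-additive and $$\mathbb V^*\Big(\limsup_{n\to\infty}\frac{|S_n|}n=+\infty\Big)<1,$$ then $C_{\mathbb V}[|X_1|]<\infty$. -/

import Mathlib

open Filter Topology MeasureTheory
open scoped ENNReal

/-- The class `C_{l,Lip}`: `|φ x - φ y| ≤ C (1 + |x|^m + |y|^m) |x - y|` for some `C > 0`, `m : ℕ`.
On `Fin n → ℝ` and on products of such spaces the sup norm is used; all norms on a
finite-dimensional space give the same class. -/
def LocLip {F : Type*} [NormedAddCommGroup F] (φ : F → ℝ) : Prop :=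
  ∃ C : ℝ, 0 < C ∧ ∃ m : ℕ, ∀ x y : F,
    |φ x - φ y| ≤ C * (1 + ‖x‖ ^ m + ‖y‖ ^ m) * ‖x - y‖

/-- A sub-linear expectation space `(Ω, H, E)` over a measurable space `Ω`: a linear space `H` of
real random variables stable under `C_{l,Lip}` maps of finitely many of its members, and a
functional `E` on `H` with values in `[-∞, ∞]`. `exp` is written as a total function for
convenience; it is constrained on `H` only, and it is evaluated on members of `H` only. -/
structure SublinearSpace (Ω : Type*) [MeasurableSpace Ω] where
  /-- the linear space of random variables -/
  H : Submodule ℝ (Ω → ℝ)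
  measurable_of_mem : ∀ X ∈ H, Measurable X
  comp_mem : ∀ (n : ℕ) (φ : (Fin n → ℝ) → ℝ), LocLip φ → ∀ X : Fin n → Ω → ℝ,
    (∀ i, X i ∈ H) → (fun ω => φ (fun i => X i ω)) ∈ H
  /-- the sub-linear (upper) expectation -/
  exp : (Ω → ℝ) → EReal
  exp_mono : ∀ X ∈ H, ∀ Y ∈ H, (∀ ω, Y ω ≤ X ω) → exp Y ≤ exp X
  exp_const : ∀ c : ℝ, exp (fun _ => c) = (c : EReal)
  exp_add_le : ∀ X ∈ H, ∀ Y ∈ H,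
    ¬ (exp X = ⊤ ∧ exp Y = ⊥) → ¬ (exp X = ⊥ ∧ exp Y = ⊤) →
      exp (fun ω => X ω + Y ω) ≤ exp X + exp Y
  exp_smul : ∀ X ∈ H, ∀ r : ℝ, 0 ≤ r → exp (fun ω => r * X ω) = (r : EReal) * exp X

namespace SublinearSpace

variable {Ω : Type*} [MeasurableSpace Ω] (S : SublinearSpace Ω)

/-- The conjugate (lower) expectation `-E[-X]`. -/
noncomputable def lowerExp (X : Ω → ℝ) : EReal := - S.exp (fun ω => - X ω)

/-- Two `n`-dimensional random vectors, with components in the respective spaces of random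
variables, are identically distributed: `E₁[φ(X)] = E₂[φ(Y)]` for all test functions `φ` for which
both sub-linear expectations are finite. -/
def IdentDistrib {Ω₁ Ω₂ : Type*} [MeasurableSpace Ω₁] [MeasurableSpace Ω₂]
    (S₁ : SublinearSpace Ω₁) (S₂ : SublinearSpace Ω₂) {n : ℕ}
    (X : Fin n → Ω₁ → ℝ) (Y : Fin n → Ω₂ → ℝ) : Prop :=
  ∀ φ : (Fin n → ℝ) → ℝ, LocLip φ →
    S₁.exp (fun ω => φ (fun i => X i ω)) ≠ ⊤ → S₁.exp (fun ω => φ (fun i => X i ω)) ≠ ⊥ →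
    S₂.exp (fun ω => φ (fun i => Y i ω)) ≠ ⊤ → S₂.exp (fun ω => φ (fun i => Y i ω)) ≠ ⊥ →
      S₁.exp (fun ω => φ (fun i => X i ω)) = S₂.exp (fun ω => φ (fun i => Y i ω))

/-- The random vector `Y` is independent to the random vector `X` (components in `H`):
`E[φ(X, Y)] = E[E[φ(x, Y)]|_{x = X}]` for all test functions `φ` with
`φ'(x) := E[|φ(x, Y)|] < ∞` for all `x` and `E[|φ'(X)|] < ∞`. As `E` is defined on `H` only, the
identity is asked for when the random variables `φ'(X)` and `E[φ(x, Y)]|_{x = X}` belong to `H`.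
The functions `x ↦ E[|φ(x, Y)|]`, `x ↦ E[φ(x, Y)]` are finite there, so `toReal` loses nothing. -/
def IndepTo {n m : ℕ} (Y : Fin n → Ω → ℝ) (X : Fin m → Ω → ℝ) : Prop :=
  ∀ φ : (Fin m → ℝ) × (Fin n → ℝ) → ℝ, LocLip φ →
    (∀ x : Fin m → ℝ, S.exp (fun ω' => |φ (x, fun j => Y j ω')|) < ⊤) →
    (fun ω => (S.exp (fun ω' => |φ (fun i => X i ω, fun j => Y j ω')|)).toReal) ∈ S.H →
    S.exp (fun ω => |(S.exp (fun ω' => |φ (fun i => X i ω, fun j => Y j ω')|)).toReal|) < ⊤ →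
    (fun ω => (S.exp (fun ω' => φ (fun i => X i ω, fun j => Y j ω'))).toReal) ∈ S.H →
      S.exp (fun ω => φ (fun i => X i ω, fun j => Y j ω)) =
        S.exp (fun ω => (S.exp (fun ω' => φ (fun i => X i ω, fun j => Y j ω'))).toReal)

/-- The random vector `Y` is negatively dependent to the random vector `X` (components in `H`).
`Monotone` and `Antitone` on `Fin n → ℝ` refer to the coordinatewise order. -/
def NegDepTo {n m : ℕ} (Y : Fin n → Ω → ℝ) (X : Fin m → Ω → ℝ) : Prop :=
  ∀ (φ₁ : (Fin m → ℝ) → ℝ) (φ₂ : (Fin n → ℝ) → ℝ), LocLip φ₁ → LocLip φ₂ →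
    (∀ ω, 0 ≤ φ₁ (fun i => X i ω)) →
    0 ≤ S.exp (fun ω => φ₂ (fun j => Y j ω)) →
    S.exp (fun ω => |φ₁ (fun i => X i ω) * φ₂ (fun j => Y j ω)|) < ⊤ →
    S.exp (fun ω => |φ₁ (fun i => X i ω)|) < ⊤ →
    S.exp (fun ω => |φ₂ (fun j => Y j ω)|) < ⊤ →
    ((Monotone φ₁ ∧ Monotone φ₂) ∨ (Antitone φ₁ ∧ Antitone φ₂)) →
      S.exp (fun ω => φ₁ (fun i => X i ω) * φ₂ (fun j => Y j ω)) ≤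
        S.exp (fun ω => φ₁ (fun i => X i ω)) * S.exp (fun ω => φ₂ (fun j => Y j ω))

/-- A sequence (`X k` is the `(k+1)`-st member) is independent: each member after the first is
independent to the vector of all earlier ones. -/
def IndepSeq (X : ℕ → Ω → ℝ) : Prop :=
  ∀ i : ℕ, S.IndepTo (fun _ : Fin 1 => X (i + 1)) (fun j : Fin (i + 1) => X j)

/-- A sequence is negatively dependent: each member after the first is negatively dependent to the
vector of all earlier ones. -/
def NegDepSeq (X : ℕ → Ω → ℝ) : Prop :=
  ∀ i : ℕ, S.NegDepTo (fun _ : Fin 1 => X (i + 1)) (fun j : Fin (i + 1) => X j)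

/-- A sequence is identically distributed: each member has the distribution of the first one. -/
def IdentDistribSeq (X : ℕ → Ω → ℝ) : Prop :=
  ∀ i : ℕ, IdentDistrib S S (fun _ : Fin 1 => X i) (fun _ : Fin 1 => X 0)

/-- The upper capacity `V(A) = inf {E[ξ] : I_A ≤ ξ, ξ ∈ H}`. The expectations here are nonnegative,
so `EReal.toENNReal` is the identity on them. -/
noncomputable def capacity (A : Set Ω) : ℝ≥0∞ :=
  ⨅ (ξ : Ω → ℝ) (_ : ξ ∈ S.H) (_ : ∀ ω, A.indicator (fun _ => (1 : ℝ)) ω ≤ ξ ω),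
    (S.exp ξ).toENNReal

/-- The outer capacity `V*(A) = inf {∑ₙ V(Aₙ) : A ⊆ ⋃ₙ Aₙ}`, over sequences of events `Aₙ`. -/
noncomputable def outerCapacity (A : Set Ω) : ℝ≥0∞ :=
  ⨅ (B : ℕ → Set Ω) (_ : ∀ n, MeasurableSet (B n)) (_ : A ⊆ ⋃ n, B n), ∑' n, S.capacity (B n)

/-- Countable sub-additivity of the sub-linear expectation: `E[X] ≤ ∑ₙ E[Xₙ]` whenever
`X ≤ ∑ₙ Xₙ` with `X, Xₙ ∈ H` nonnegative. Both series are series of nonnegative terms, with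
sums in `[0, ∞]`. -/
def CountablySubadditive : Prop :=
  ∀ (X : Ω → ℝ) (Y : ℕ → Ω → ℝ), X ∈ S.H → (∀ n, Y n ∈ S.H) →
    (∀ ω, 0 ≤ X ω) → (∀ n ω, 0 ≤ Y n ω) →
    (∀ ω, ENNReal.ofReal (X ω) ≤ ∑' n, ENNReal.ofReal (Y n ω)) →
      (S.exp X).toENNReal ≤ ∑' n, (S.exp (Y n)).toENNReal

end SublinearSpace

/-- The Choquet integral `∫₀^∞ V(X ≥ t) dt + ∫_{-∞}^0 (V(X ≥ t) - 1) dt` with respect to a set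
function `V` with values in `[0, 1]`. It is meant for `X` for which not both integrals are
infinite, in particular for `X ≥ 0`. -/
noncomputable def choquet {Ω : Type*} (V : Set Ω → ℝ≥0∞) (X : Ω → ℝ) : EReal :=
  ((∫⁻ t in Set.Ioi (0 : ℝ), V {ω | t ≤ X ω} : ℝ≥0∞) : EReal)
    - ((∫⁻ t in Set.Iio (0 : ℝ), (1 - V {ω | t ≤ X ω}) : ℝ≥0∞) : EReal)

/-- Continuity of a capacity on the events, from below and from above. -/
def ContinuousCapacity {Ω : Type*} [MeasurableSpace Ω] (V : Set Ω → ℝ≥0∞) : Prop :=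
  (∀ A : ℕ → Set Ω, (∀ n, MeasurableSet (A n)) → Monotone A →
    Tendsto (fun n => V (A n)) atTop (𝓝 (V (⋃ n, A n)))) ∧
  (∀ A : ℕ → Set Ω, (∀ n, MeasurableSet (A n)) → Antitone A →
    Tendsto (fun n => V (A n)) atTop (𝓝 (V (⋂ n, A n))))

/-- The averages `S_n / n` of a sequence of random variables, `S_n` being the sum of the first `n`
members, as extended reals (so that upper and lower limits may be infinite). -/
noncomputable def partialAverage {Ω : Type*} (X : ℕ → Ω → ℝ) (n : ℕ) (ω : Ω) : EReal :=
  (((∑ k ∈ Finset.range n, X k ω) / (n : ℝ) : ℝ) : EReal)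

/-- The quotients `|S_n| / n`, as extended reals. -/
noncomputable def absPartialAverage {Ω : Type*} (X : ℕ → Ω → ℝ) (n : ℕ) (ω : Ω) : EReal :=
  ((|∑ k ∈ Finset.range n, X k ω| / (n : ℝ) : ℝ) : EReal)

/-! Part (a). Truncate the `i`-th variable at height `i + 1`, center it by its upper expectation to
get `z i`, and let `W n` be the largest of `0` and the suffix sums `z k + ... + z (n-1)`. Then `W
(n+1) = max (W n + z n) 0`, so `W (n+1)^2 ≤ W n^2 + 2 W n z n + (z n)^2`. As `W n` is a nonnegative
nondecreasing function of the earlier variables and `E[z n] = 0`, negative dependence makes the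
cross term nonpositive, hence `E[W n^2] ≤ ∑ E[(z i)^2]` (`NegDepSeq.rexp_sq_suffixMax_le`).
Chebyshev's inequality along `⌊c^j⌋` gives a series controlled by `C_V[|X|]`
(`NegDepSeq.tsum_capacity_suffixMax_ne_top`), and Borel–Cantelli for the outer measure `V*` applies.
Suffix sums serve twice: the whole sum up to `m = ⌊c^j⌋` is one, and for `-X` so is the block sum
over `[n, m)`, so the upper bound at `m` passes to every `n` just below `m`
(`sum_range_le_of_suffixMax`). The lower half is the upper half for `-X`.

Part (b). If the Choquet integral is infinite, the tail expectations at heights `M (i + 1) + 1` have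
a divergent sum for every `M`. Independence gives `E[1 - ∏ (1 - ξ i)] = 1 - ∏ (1 - E[ξ i])` for
ramps `ξ i` of these tails, which tends to `1`; countable sub-additivity turns this into `V* ≥ 1`
for the event that `|X i| ≥ M (i + 1)` for some `i ≥ M`. Continuity from above lets `M → ∞`, and on
the limit event `|S_n| / n` is unbounded. -/

/-! ### Lipschitz test functions of finitely many coordinates. -/

/-- A function of a real sequence that is Lipschitz with respect to the sum of the distances of the
first `n` coordinates (in particular it depends on these coordinates only). -/
def LipFirst (n : ℕ) (f : (ℕ → ℝ) → ℝ) : Prop :=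
  ∃ C : ℝ, 0 ≤ C ∧ ∀ x y : ℕ → ℝ, |f x - f y| ≤ C * ∑ j ∈ Finset.range n, |x j - y j|

/-- Extension of a finite vector by zero to a sequence. -/
def extendZero {n : ℕ} (v : Fin n → ℝ) (j : ℕ) : ℝ := if h : j < n then v ⟨j, h⟩ else 0

lemma LipFirst.congr {n : ℕ} {f : (ℕ → ℝ) → ℝ} (hf : LipFirst n f) {x y : ℕ → ℝ}
    (h : ∀ j < n, x j = y j) : f x = f y := by
  obtain ⟨C, -, hC⟩ := hf
  have h1 := hC x y
  rw [Finset.sum_eq_zero] at h1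
  · rw [mul_zero] at h1
    exact sub_eq_zero.1 (abs_nonpos_iff.1 h1)
  · intro j hj
    rw [h j (Finset.mem_range.1 hj), sub_self, abs_zero]

/-- Bridge between functions of a sequence, on which induction over `n` is painless, and the
functions on `Fin n → ℝ` used in the definitions of dependence. -/
lemma LipFirst.extendZero_eq {n : ℕ} {f : (ℕ → ℝ) → ℝ} (hf : LipFirst n f) (x : ℕ → ℝ) :
    f (extendZero fun i : Fin n => x i) = f x :=
  hf.congr fun j hj => by simp [extendZero, hj]

lemma locLip_of_lip {F : Type*} [NormedAddCommGroup F] {φ : F → ℝ} {C : ℝ} (hC : 0 ≤ C)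
    (h : ∀ x y, |φ x - φ y| ≤ C * ‖x - y‖) : LocLip φ := by
  refine ⟨C + 1, by linarith, 0, fun x y => (h x y).trans ?_⟩
  gcongr
  simp only [pow_zero]
  linarith

lemma abs_extendZero_sub_le {n : ℕ} (v w : Fin n → ℝ) (j : ℕ) :
    |extendZero v j - extendZero w j| ≤ ‖v - w‖ := by
  unfold extendZero
  split_ifs with h
  · exact norm_le_pi_norm (v - w) ⟨j, h⟩
  · simp

lemma LipFirst.bound_extendZero {n : ℕ} {f : (ℕ → ℝ) → ℝ} (hf : LipFirst n f) :
    ∃ C : ℝ, 0 ≤ C ∧ ∀ v w : Fin n → ℝ, |f (extendZero v) - f (extendZero w)| ≤ C * ‖v - w‖ := by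
  obtain ⟨C, hC0, hC⟩ := hf
  refine ⟨C * n, by positivity, fun v w => (hC _ _).trans ?_⟩
  rw [mul_assoc]
  gcongr
  calc ∑ j ∈ Finset.range n, |extendZero v j - extendZero w j|
      ≤ ∑ j ∈ Finset.range n, ‖v - w‖ := Finset.sum_le_sum fun j _ => abs_extendZero_sub_le v w j
    _ = n * ‖v - w‖ := by simp

lemma LipFirst.locLip_extendZero {n : ℕ} {f : (ℕ → ℝ) → ℝ} (hf : LipFirst n f) :
    LocLip fun v : Fin n → ℝ => f (extendZero v) := by
  obtain ⟨C, hC, h⟩ := hf.bound_extendZero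
  exact locLip_of_lip hC h

lemma locLip_eval_zero {g : ℝ → ℝ} {C : ℝ} (hC : 0 ≤ C) (h : ∀ x y, |g x - g y| ≤ C * |x - y|) :
    LocLip fun v : Fin 1 → ℝ => g (v 0) :=
  locLip_of_lip hC fun x y => (h _ _).trans
    (mul_le_mul_of_nonneg_left (norm_le_pi_norm (x - y) 0) hC)

/-! ### Real-valued calculus of the sub-linear expectation. -/

namespace SublinearSpace

variable {Ω : Type*} [MeasurableSpace Ω] (S : SublinearSpace Ω)

lemma comp_lipFirst_mem {n : ℕ} {f : (ℕ → ℝ) → ℝ} (hf : LipFirst n f) {X : ℕ → Ω → ℝ}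
    (hX : ∀ n, X n ∈ S.H) : (fun ω => f fun j => X j ω) ∈ S.H := by
  have := S.comp_mem n _ hf.locLip_extendZero (fun i : Fin n => X i) fun i => hX i
  refine (congrArg (· ∈ S.H) (funext fun ω => ?_)).mp this
  exact hf.extendZero_eq fun j => X j ω

lemma const_mem (c : ℝ) : (fun _ : Ω => c) ∈ S.H :=
  S.comp_mem 0 (fun _ => c) (locLip_of_lip le_rfl fun x y => by simp) (fun _ _ => 0)
    fun i => i.elim0

lemma comp_lip_mem {g : ℝ → ℝ} {C : ℝ} (hC : 0 ≤ C) (h : ∀ x y, |g x - g y| ≤ C * |x - y|)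
    {X : Ω → ℝ} (hX : X ∈ S.H) : (fun ω => g (X ω)) ∈ S.H :=
  S.comp_mem 1 (fun v => g (v 0)) (locLip_eval_zero hC h) (fun _ => X) fun _ => hX

lemma abs_mem {X : Ω → ℝ} (hX : X ∈ S.H) : (fun ω => |X ω|) ∈ S.H :=
  S.comp_lip_mem (g := fun x => |x|) zero_le_one
    (fun x y => by simpa using abs_abs_sub_abs_le x y) hX

lemma mul_mem {X Y : Ω → ℝ} (hX : X ∈ S.H) (hY : Y ∈ S.H) : (fun ω => X ω * Y ω) ∈ S.H := by
  refine S.comp_mem 2 (fun v => v 0 * v 1) ⟨1, one_pos, 1, fun x y => ?_⟩ ![X, Y] ?_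
  · have h0 : |x 0 - y 0| ≤ ‖x - y‖ := norm_le_pi_norm (x - y) 0
    have h1 : |x 1 - y 1| ≤ ‖x - y‖ := norm_le_pi_norm (x - y) 1
    have h2 : |x 0| ≤ ‖x‖ := norm_le_pi_norm x 0
    have h3 : |y 1| ≤ ‖y‖ := norm_le_pi_norm y 1
    calc |x 0 * x 1 - y 0 * y 1| = |x 0 * (x 1 - y 1) + (x 0 - y 0) * y 1| := by ring_nf
      _ ≤ |x 0| * |x 1 - y 1| + |x 0 - y 0| * |y 1| := by
        rw [← abs_mul, ← abs_mul]; exact abs_add_le _ _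
      _ ≤ ‖x‖ * ‖x - y‖ + ‖x - y‖ * ‖y‖ := by gcongr
      _ ≤ 1 * (1 + ‖x‖ ^ 1 + ‖y‖ ^ 1) * ‖x - y‖ := by
        have := norm_nonneg (x - y)
        nlinarith
  · intro i
    fin_cases i <;> simpa

/-- The members of `H` with finite absolute moment. -/
def FinExp (X : Ω → ℝ) : Prop := X ∈ S.H ∧ S.exp (fun ω => |X ω|) < ⊤

/-- The sub-linear expectation as a real number. -/
noncomputable def rexp (X : Ω → ℝ) : ℝ := (S.exp X).toReal

variable {S}

lemma FinExp.of_abs_le {X Y : Ω → ℝ} (hX : X ∈ S.H) (hY : S.FinExp Y) (h : ∀ ω, |X ω| ≤ Y ω) :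
    S.FinExp X :=
  ⟨hX, (S.exp_mono _ (S.abs_mem hY.1) _ (S.abs_mem hX)
    fun ω => (h ω).trans (le_abs_self _)).trans_lt hY.2⟩

variable (S) in
lemma finExp_const (c : ℝ) : S.FinExp fun _ => c :=
  ⟨S.const_mem c, by rw [S.exp_const]; exact EReal.coe_lt_top _⟩

lemma FinExp.of_bdd {X : Ω → ℝ} (hX : X ∈ S.H) {C : ℝ} (h : ∀ ω, |X ω| ≤ C) : S.FinExp X :=
  .of_abs_le hX (S.finExp_const C) h

lemma FinExp.abs {X : Ω → ℝ} (hX : S.FinExp X) : S.FinExp fun ω => |X ω| :=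
  ⟨S.abs_mem hX.1, by simpa using hX.2⟩

lemma FinExp.smul {X : Ω → ℝ} (hX : S.FinExp X) (r : ℝ) : S.FinExp fun ω => r * X ω := by
  refine ⟨S.H.smul_mem r hX.1, ?_⟩
  simp only [abs_mul]
  rw [S.exp_smul _ (S.abs_mem hX.1) _ (abs_nonneg r)]
  have h0 : 0 ≤ S.exp fun ω => |X ω| := by
    have := S.exp_mono _ (S.abs_mem hX.1) _ (S.const_mem 0) fun ω => abs_nonneg _
    rwa [S.exp_const] at this
  lift (S.exp fun ω => |X ω|) to ℝ using ⟨hX.2.ne, (EReal.bot_lt_zero.trans_le h0).ne'⟩ with a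
  rw [← EReal.coe_mul]
  exact EReal.coe_lt_top _

lemma FinExp.neg {X : Ω → ℝ} (hX : S.FinExp X) : S.FinExp fun ω => - X ω :=
  ⟨S.H.neg_mem hX.1, by simpa using hX.2⟩

lemma FinExp.add {X Y : Ω → ℝ} (hX : S.FinExp X) (hY : S.FinExp Y) :
    S.FinExp fun ω => X ω + Y ω := by
  refine ⟨S.H.add_mem hX.1 hY.1, ?_⟩
  refine (S.exp_mono _ (S.H.add_mem (S.abs_mem hX.1) (S.abs_mem hY.1)) _
    (S.abs_mem (S.H.add_mem hX.1 hY.1)) fun ω => abs_add_le _ _).trans_lt ?_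
  refine (S.exp_add_le _ (S.abs_mem hX.1) _ (S.abs_mem hY.1) ?_ ?_).trans_lt
    (EReal.add_lt_top hX.2.ne hY.2.ne)
  · exact fun h => hX.2.ne h.1
  · exact fun h => hY.2.ne h.2

lemma FinExp.sub {X Y : Ω → ℝ} (hX : S.FinExp X) (hY : S.FinExp Y) :
    S.FinExp fun ω => X ω - Y ω := by
  simpa only [sub_eq_add_neg] using hX.add hY.neg

lemma FinExp.sum {ι : Type*} (s : Finset ι) {X : ι → Ω → ℝ} (hX : ∀ i ∈ s, S.FinExp (X i)) :
    S.FinExp fun ω => ∑ i ∈ s, X i ω := by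
  classical
  induction s using Finset.induction_on with
  | empty => simpa using S.finExp_const 0
  | insert a s ha ih =>
    simp only [Finset.sum_insert ha]
    exact (hX a (by simp)).add (ih fun i hi => hX i (by simp [hi]))

/-- The value `-∞` is excluded by `0 = E[X - X] ≤ E[X] + E[-X]`, where `E[-X] < ∞`. -/
lemma FinExp.coe_rexp {X : Ω → ℝ} (hX : S.FinExp X) : (S.rexp X : EReal) = S.exp X := by
  have h1 : S.exp X < ⊤ :=
    (S.exp_mono _ (S.abs_mem hX.1) _ hX.1 fun ω => le_abs_self _).trans_lt hX.2
  have h2 : S.exp (fun ω => - X ω) < ⊤ :=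
    (S.exp_mono _ (S.abs_mem hX.1) _ (S.H.neg_mem hX.1) fun ω => neg_le_abs _).trans_lt hX.2
  refine EReal.coe_toReal h1.ne fun h => ?_
  have h3 := S.exp_add_le _ hX.1 _ (S.H.neg_mem hX.1) (fun h => h1.ne h.1) (fun h => h2.ne h.2)
  simp only [Pi.neg_apply, add_neg_cancel, S.exp_const] at h3
  rw [h, EReal.bot_add] at h3
  simp at h3

variable (S) in
lemma rexp_const (c : ℝ) : S.rexp (fun _ => c) = c := by simp [rexp, S.exp_const]

lemma rexp_mono {X Y : Ω → ℝ} (hX : S.FinExp X) (hY : S.FinExp Y) (h : ∀ ω, X ω ≤ Y ω) :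
    S.rexp X ≤ S.rexp Y := by
  rw [← EReal.coe_le_coe_iff, hX.coe_rexp, hY.coe_rexp]
  exact S.exp_mono _ hY.1 _ hX.1 h

lemma rexp_nonneg {X : Ω → ℝ} (hX : S.FinExp X) (h : ∀ ω, 0 ≤ X ω) : 0 ≤ S.rexp X := by
  simpa [S.rexp_const] using rexp_mono (S.finExp_const 0) hX h

lemma rexp_le_of_le {X : Ω → ℝ} (hX : S.FinExp X) {c : ℝ} (h : ∀ ω, X ω ≤ c) : S.rexp X ≤ c := by
  simpa [S.rexp_const] using rexp_mono hX (S.finExp_const c) h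

lemma rexp_add_le {X Y : Ω → ℝ} (hX : S.FinExp X) (hY : S.FinExp Y) :
    S.rexp (fun ω => X ω + Y ω) ≤ S.rexp X + S.rexp Y := by
  rw [← EReal.coe_le_coe_iff, EReal.coe_add, hX.coe_rexp, hY.coe_rexp, (hX.add hY).coe_rexp]
  refine S.exp_add_le _ hX.1 _ hY.1 ?_ ?_
  · rw [← hX.coe_rexp]; exact fun h => EReal.coe_ne_top _ h.1
  · rw [← hX.coe_rexp]; exact fun h => EReal.coe_ne_bot _ h.1

lemma rexp_smul {X : Ω → ℝ} (hX : X ∈ S.H) {r : ℝ} (hr : 0 ≤ r) :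
    S.rexp (fun ω => r * X ω) = r * S.rexp X := by
  rw [rexp, S.exp_smul _ hX _ hr, EReal.toReal_mul, EReal.toReal_coe, rexp]

lemma rexp_sum_le {ι : Type*} (s : Finset ι) {X : ι → Ω → ℝ} (hX : ∀ i ∈ s, S.FinExp (X i)) :
    S.rexp (fun ω => ∑ i ∈ s, X i ω) ≤ ∑ i ∈ s, S.rexp (X i) := by
  classical
  induction s using Finset.induction_on with
  | empty => simp [S.rexp_const]
  | insert a s ha ih =>
    simp only [Finset.sum_insert ha]
    have hs : ∀ i ∈ s, S.FinExp (X i) := fun i hi => hX i (by simp [hi])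
    exact (rexp_add_le (hX a (by simp)) (.sum s hs)).trans (by gcongr; exact ih hs)

lemma rexp_add_const {X : Ω → ℝ} (hX : S.FinExp X) (c : ℝ) :
    S.rexp (fun ω => X ω + c) = S.rexp X + c := by
  refine le_antisymm ((rexp_add_le hX (S.finExp_const c)).trans_eq (by rw [S.rexp_const])) ?_
  have := rexp_add_le (hX.add (S.finExp_const c)) (S.finExp_const (-c))
  simp only [S.rexp_const, add_neg_cancel_right] at this
  linarith

lemma rexp_sub_const {X : Ω → ℝ} (hX : S.FinExp X) (c : ℝ) :
    S.rexp (fun ω => X ω - c) = S.rexp X - c := by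
  simpa only [sub_eq_add_neg] using rexp_add_const hX (-c)

lemma neg_rexp_le {X : Ω → ℝ} (hX : S.FinExp X) : - S.rexp X ≤ S.rexp fun ω => - X ω := by
  have := rexp_add_le hX hX.neg
  simp only [add_neg_cancel, S.rexp_const] at this
  linarith

lemma rexp_sub_le {X Y : Ω → ℝ} (hX : S.FinExp X) (hY : S.FinExp Y) :
    S.rexp X - S.rexp Y ≤ S.rexp fun ω => |X ω - Y ω| := by
  have h1 := rexp_add_le hY (hX.sub hY)
  simp only [add_sub_cancel] at h1
  have h2 := rexp_mono (hX.sub hY) (hX.sub hY).abs fun ω => le_abs_self _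
  linarith

/-- With `c = E[X]`, take expectations in `c X ≤ (X^2 + c^2) / 2`. -/
lemma sq_rexp_le {X : Ω → ℝ} (hX : S.FinExp X) (hX2 : S.FinExp fun ω => X ω ^ 2) :
    S.rexp X ^ 2 ≤ S.rexp fun ω => X ω ^ 2 := by
  set c := S.rexp X with hc
  -- Homogeneity holds for nonnegative factors only; for `c < 0` it is applied to `-X`, with `E[-X]
  -- ≥ -c`.
  have h1 : c * c ≤ S.rexp fun ω => c * X ω := by
    rcases le_total 0 c with h | h
    · rw [rexp_smul hX.1 h]
    · have h2 : (fun ω => c * X ω) = fun ω => (-c) * (- X ω) := by ext; ring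
      rw [h2, rexp_smul hX.neg.1 (neg_nonneg.2 h)]
      have := neg_rexp_le hX
      nlinarith
  have h3 := rexp_mono (hX.smul c) (((hX2.add (S.finExp_const (c ^ 2)))).smul (1 / 2))
    fun ω => by nlinarith [sq_nonneg (X ω - c)]
  rw [rexp_smul (hX2.add (S.finExp_const (c ^ 2))).1 (by norm_num), rexp_add_const hX2] at h3
  nlinarith

lemma rexp_sub_sq_le {X : Ω → ℝ} (hX : S.FinExp X) (hX2 : S.FinExp fun ω => X ω ^ 2) :
    S.rexp (fun ω => (X ω - S.rexp X) ^ 2) ≤ 4 * S.rexp fun ω => X ω ^ 2 := by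
  set c := S.rexp X with hc
  have h := (hX2.smul 2).add (S.finExp_const (2 * c ^ 2))
  have hm : (fun ω => (X ω - c) ^ 2) ∈ S.H := by
    simpa only [pow_two] using
      S.mul_mem (hX.sub (S.finExp_const c)).1 (hX.sub (S.finExp_const c)).1
  have hle : ∀ ω, (X ω - c) ^ 2 ≤ 2 * X ω ^ 2 + 2 * c ^ 2 := fun ω => by
    nlinarith [sq_nonneg (X ω + c)]
  have h1 := rexp_mono (FinExp.of_abs_le hm h fun ω => by
    rw [abs_of_nonneg (sq_nonneg _)]; exact hle ω) h hle
  rw [rexp_add_const (hX2.smul 2), rexp_smul hX2.1 (by norm_num)] at h1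
  have := sq_rexp_le hX hX2
  linarith

end SublinearSpace

/-! ### The upper capacity and the outer capacity. -/

namespace SublinearSpace

variable {Ω : Type*} [MeasurableSpace Ω] {S : SublinearSpace Ω}

lemma FinExp.toENNReal_exp {X : Ω → ℝ} (hX : S.FinExp X) :
    (S.exp X).toENNReal = ENNReal.ofReal (S.rexp X) :=
  EReal.toENNReal_of_ne_top (by rw [← hX.coe_rexp]; exact EReal.coe_ne_top _)

lemma capacity_le_rexp {A : Set Ω} {ξ : Ω → ℝ} (hξ : S.FinExp ξ) (h0 : ∀ ω, 0 ≤ ξ ω)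
    (h1 : ∀ ω ∈ A, 1 ≤ ξ ω) : S.capacity A ≤ ENNReal.ofReal (S.rexp ξ) := by
  rw [← hξ.toENNReal_exp]
  exact iInf_le_of_le ξ <| iInf_le_of_le hξ.1 <|
    iInf_le _ fun ω => Set.indicator_le' (fun ω h => h1 ω h) (fun ω _ => h0 ω) ω

lemma rexp_le_capacity {A : Set Ω} {η : Ω → ℝ} (hη : S.FinExp η)
    (h : ∀ ω, η ω ≤ A.indicator (fun _ => 1) ω) : ENNReal.ofReal (S.rexp η) ≤ S.capacity A := by
  rw [← hη.toENNReal_exp]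
  exact le_iInf fun ξ => le_iInf fun hξ => le_iInf fun hA =>
    EReal.toENNReal_le_toENNReal (S.exp_mono _ hξ _ hη.1 fun ω => (h ω).trans (hA ω))

variable (S) in
lemma capacity_mono {A B : Set Ω} (h : A ⊆ B) : S.capacity A ≤ S.capacity B :=
  le_iInf fun ξ => le_iInf fun hξ => le_iInf fun hB => iInf_le_of_le ξ <| iInf_le_of_le hξ <|
    iInf_le _ fun ω => (Set.indicator_le_indicator_of_subset h (fun _ => zero_le_one) ω).trans (hB ω)

variable (S) in
lemma capacity_empty : S.capacity ∅ = 0 := by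
  have := capacity_le_rexp (A := ∅) (S.finExp_const 0) (fun _ => le_rfl) (by simp)
  simpa [S.rexp_const] using this

variable (S) in
lemma capacity_univ : S.capacity Set.univ = 1 := by
  apply le_antisymm
  · have := capacity_le_rexp (A := Set.univ) (S.finExp_const 1) (fun _ => zero_le_one) (by simp)
    simpa [S.rexp_const] using this
  · have := rexp_le_capacity (A := Set.univ) (S.finExp_const 1) (by simp)
    simpa [S.rexp_const] using this

variable (S) in
/-- The outer capacity as an outer measure. -/
noncomputable def capacityOuterMeasure : OuterMeasure Ω :=
  inducedOuterMeasure (fun A (_ : MeasurableSet A) => S.capacity A) MeasurableSet.empty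
    S.capacity_empty

variable (S) in
-- The induced outer measure allows covers by arbitrary sets but charges `∞` for a nonmeasurable
-- one, so the infimum is unchanged. Null unions and Borel–Cantelli for `V*` thus come from outer
-- measures.
lemma capacityOuterMeasure_apply (A : Set Ω) : S.capacityOuterMeasure A = S.outerCapacity A := by
  rw [capacityOuterMeasure, inducedOuterMeasure, OuterMeasure.ofFunction_apply, outerCapacity]
  apply le_antisymm
  · refine le_iInf fun B => le_iInf fun hB => le_iInf fun hA => iInf_le_of_le B <|
      iInf_le_of_le hA ?_
    simp only [extend_eq _ (hB _), le_refl]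
  · refine le_iInf fun B => le_iInf fun hA => ?_
    by_cases hB : ∀ n, MeasurableSet (B n)
    · simp only [extend_eq _ (hB _)]
      exact iInf_le_of_le B <| iInf_le_of_le hB <| iInf_le _ hA
    · push Not at hB
      obtain ⟨n, hn⟩ := hB
      rw [ENNReal.tsum_eq_top_of_eq_top ⟨n, by simp [extend, hn]⟩]
      exact le_top

lemma capacityOuterMeasure_le {A : Set Ω} (hA : MeasurableSet A) :
    S.capacityOuterMeasure A ≤ S.capacity A := by
  rw [capacityOuterMeasure, inducedOuterMeasure]
  exact (OuterMeasure.ofFunction_le _).trans_eq (extend_eq _ hA)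

/-- Under countable sub-additivity, a member of `H` between `0` and the indicator of an event has
expectation at most the outer capacity of the event. -/
lemma CountablySubadditive.rexp_le_outerCapacity (hS : S.CountablySubadditive) {A : Set Ω}
    {η : Ω → ℝ} (hη : S.FinExp η) (h0 : ∀ ω, 0 ≤ η ω)
    (h : ∀ ω, η ω ≤ A.indicator (fun _ => 1) ω) :
    ENNReal.ofReal (S.rexp η) ≤ S.outerCapacity A := by
  rw [← hη.toENNReal_exp]
  refine le_iInf fun B => le_iInf fun hB => le_iInf fun hA => ?_
  refine ENNReal.le_of_forall_pos_le_add fun ε hε _ => ?_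
  obtain ⟨δ, hδ, hδε⟩ := ENNReal.exists_pos_sum_of_countable' (ε := (ε : ℝ≥0∞)) (by simpa using hε.ne') ℕ
  -- Nearly optimal majorants of the covering events, with errors summing to less than `ε`; their
  -- sum dominates `η` pointwise.
  have key : ∀ n, ∃ ξ : Ω → ℝ, ξ ∈ S.H ∧
      (∀ ω, (B n).indicator (fun _ => (1 : ℝ)) ω ≤ ξ ω) ∧
      (S.exp ξ).toENNReal ≤ S.capacity (B n) + δ n := by
    intro n
    have hlt : S.capacity (B n) < S.capacity (B n) + δ n := by
      refine ENNReal.lt_add_right (ne_top_of_le_ne_top ENNReal.one_ne_top ?_) (hδ n).ne'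
      exact (S.capacity_mono (Set.subset_univ _)).trans_eq S.capacity_univ
    rw [capacity] at hlt
    simp only [iInf_lt_iff] at hlt
    obtain ⟨ξ, h1, h2, h3⟩ := hlt
    exact ⟨ξ, h1, h2, h3.le⟩
  choose ξ h1 h2 h3 using key
  have h4 : ∀ n ω, 0 ≤ ξ n ω := fun n ω =>
    (Set.indicator_nonneg (fun _ _ => zero_le_one) ω).trans (h2 n ω)
  calc (S.exp η).toENNReal ≤ ∑' n, (S.exp (ξ n)).toENNReal := by
        refine hS η ξ hη.1 h1 h0 h4 fun ω => ?_
        by_cases hω : ω ∈ A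
        · obtain ⟨n, hn⟩ := Set.mem_iUnion.1 (hA hω)
          refine (ENNReal.ofReal_le_ofReal (((h ω).trans_eq ?_).trans (h2 n ω))).trans
            (ENNReal.le_tsum n)
          simp [hω, hn]
        · have := h ω
          rw [Set.indicator_of_notMem hω] at this
          rw [ENNReal.ofReal_of_nonpos this]
          exact zero_le
    _ ≤ ∑' n, (S.capacity (B n) + δ n) := ENNReal.tsum_le_tsum h3
    _ ≤ ∑' n, S.capacity (B n) + ε := by
        rw [ENNReal.tsum_add]
        gcongr

end SublinearSpace

/-! ### Integrals of decreasing functions against series. -/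

lemma lintegral_Ioi_eq_tsum (f : ℝ → ℝ≥0∞) {c : ℝ} (hc : 0 < c) :
    ∫⁻ t in Set.Ioi (0 : ℝ), f t = ∑' n : ℕ, ∫⁻ t in Set.Ioc (c * n) (c * (n + 1)), f t := by
  have hm : Monotone fun n : ℕ => c * n := fun a b h => by
    simp only; gcongr
  have hU : Set.Ioi (0 : ℝ) = ⋃ n : ℕ, Set.Ioc (c * n) (c * (n + 1)) := by
    ext t
    simp only [Set.mem_Ioi, Set.mem_iUnion, Set.mem_Ioc]
    constructor
    · intro ht
      have h1 : 0 < ⌈t / c⌉₊ := Nat.ceil_pos.2 (by positivity)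
      refine ⟨⌈t / c⌉₊ - 1, ?_, ?_⟩
      · have h2 : ((⌈t / c⌉₊ - 1 : ℕ) : ℝ) < t / c := Nat.lt_ceil.1 (by omega)
        rw [lt_div_iff₀ hc] at h2
        linarith
      · have h2 := Nat.le_ceil (t / c)
        rw [div_le_iff₀ hc] at h2
        rw [Nat.cast_sub (by omega)]
        push_cast
        linarith
    · rintro ⟨n, hn, -⟩
      exact lt_of_le_of_lt (by positivity) hn
  rw [hU, lintegral_iUnion (fun _ => measurableSet_Ioc)]
  have := hm.pairwise_disjoint_on_Ioc_succ
  intro i j hij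
  simpa [Function.onFun] using this hij

lemma tsum_mul_le_lintegral_Ioi {f : ℝ → ℝ≥0∞} (hf : Antitone f) {c : ℝ} (hc : 0 < c) :
    ∑' n : ℕ, f (c * (n + 1)) * ENNReal.ofReal c ≤ ∫⁻ t in Set.Ioi (0 : ℝ), f t := by
  rw [lintegral_Ioi_eq_tsum f hc]
  refine ENNReal.tsum_le_tsum fun n => ?_
  calc f (c * (n + 1)) * ENNReal.ofReal c
      = ∫⁻ t in Set.Ioc (c * n) (c * (n + 1)), f (c * (n + 1)) := by
        rw [setLIntegral_const, Real.volume_Ioc]; congr 2; ring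
    _ ≤ _ := setLIntegral_mono' measurableSet_Ioc fun t ht => hf ht.2

lemma lintegral_Ioi_le_tsum_mul {f : ℝ → ℝ≥0∞} (hf : Antitone f) {c : ℝ} (hc : 0 < c) :
    ∫⁻ t in Set.Ioi (0 : ℝ), f t ≤ ∑' n : ℕ, f (c * n) * ENNReal.ofReal c := by
  rw [lintegral_Ioi_eq_tsum f hc]
  refine ENNReal.tsum_le_tsum fun n => ?_
  calc _ ≤ ∫⁻ t in Set.Ioc (c * n) (c * (n + 1)), f (c * n) :=
        setLIntegral_mono' measurableSet_Ioc fun t ht => hf ht.1.le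
    _ = f (c * n) * ENNReal.ofReal c := by
        rw [setLIntegral_const, Real.volume_Ioc]; congr 2; ring

namespace SublinearSpace

variable {Ω : Type*} [MeasurableSpace Ω] (S : SublinearSpace Ω)

lemma antitone_capacity_ge (X : Ω → ℝ) : Antitone fun t : ℝ => S.capacity {ω | t ≤ X ω} :=
  fun _ _ h => S.capacity_mono fun _ hω => h.trans hω

lemma choquet_lt_top_iff {X : Ω → ℝ} (hX : ∀ ω, 0 ≤ X ω) :
    choquet S.capacity X < ⊤ ↔ ∫⁻ t in Set.Ioi (0 : ℝ), S.capacity {ω | t ≤ X ω} < ⊤ := by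
  have h : ∫⁻ t in Set.Iio (0 : ℝ), (1 - S.capacity {ω | t ≤ X ω}) = 0 := by
    rw [setLIntegral_congr_fun (g := fun _ => 0) measurableSet_Iio]
    · simp
    · intro t ht
      have : {ω | t ≤ X ω} = Set.univ := Set.eq_univ_of_forall fun ω => ht.le.trans (hX ω)
      simp [this, S.capacity_univ]
  rw [choquet, h, EReal.coe_ennreal_zero, sub_zero, lt_top_iff_ne_top, lt_top_iff_ne_top, ne_eq,
    EReal.coe_ennreal_eq_top_iff]

end SublinearSpace

/-! ### Lipschitz substitutes for tail indicators. -/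

/-- A piecewise linear function between the indicators of `l ≤ |x|` and of `l - 1 ≤ |x|`. -/
noncomputable def tailRamp (l x : ℝ) : ℝ := max 0 (min 1 (|x| - l + 1))

lemma tailRamp_nonneg (l x : ℝ) : 0 ≤ tailRamp l x := le_max_left _ _

lemma tailRamp_le_one (l x : ℝ) : tailRamp l x ≤ 1 := max_le zero_le_one (min_le_left _ _)

lemma tailRamp_eq_one {l x : ℝ} (h : l ≤ |x|) : tailRamp l x = 1 := by
  rw [tailRamp, min_eq_left (by linarith), max_eq_right zero_le_one]

lemma tailRamp_eq_zero {l x : ℝ} (h : |x| ≤ l - 1) : tailRamp l x = 0 :=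
  max_eq_left ((min_le_right _ _).trans (by linarith))

lemma abs_tailRamp_sub_le (l x y : ℝ) : |tailRamp l x - tailRamp l y| ≤ 1 * |x - y| := by
  rw [one_mul, tailRamp, tailRamp]
  refine (abs_max_sub_max_le_max _ _ _ _).trans (max_le (by simp) ?_)
  refine (abs_min_sub_min_le_max _ _ _ _).trans (max_le (by simp) ?_)
  have : |x| - l + 1 - (|y| - l + 1) = |x| - |y| := by ring
  rw [this]
  exact abs_abs_sub_abs_le x y

namespace SublinearSpace

variable {Ω : Type*} [MeasurableSpace Ω] {S : SublinearSpace Ω}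

lemma finExp_tailRamp {X : Ω → ℝ} (hX : X ∈ S.H) (l : ℝ) :
    S.FinExp fun ω => tailRamp l (X ω) :=
  .of_bdd (S.comp_lip_mem zero_le_one (abs_tailRamp_sub_le l) hX) (C := 1) fun ω => by
    rw [abs_of_nonneg (tailRamp_nonneg _ _)]; exact tailRamp_le_one _ _

/-- Bounded Lipschitz functions have the same expectation under identical distribution. -/
lemma IdentDistribSeq.rexp_eq {X : ℕ → Ω → ℝ} (hid : S.IdentDistribSeq X) (hX : ∀ n, X n ∈ S.H)
    {g : ℝ → ℝ} {C K : ℝ} (hC : 0 ≤ C) (hg : ∀ x y, |g x - g y| ≤ C * |x - y|)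
    (hK : ∀ x, |g x| ≤ K) (n : ℕ) :
    S.rexp (fun ω => g (X n ω)) = S.rexp fun ω => g (X 0 ω) := by
  have h : ∀ k, S.FinExp fun ω => g (X k ω) := fun k =>
    .of_bdd (S.comp_lip_mem hC hg (hX k)) fun ω => hK _
  have := hid n (fun v => g (v 0)) (locLip_eval_zero hC hg)
  rw [← (h n).coe_rexp, ← (h 0).coe_rexp] at this
  exact EReal.coe_eq_coe_iff.1 (this (EReal.coe_ne_top _) (EReal.coe_ne_bot _)
    (EReal.coe_ne_top _) (EReal.coe_ne_bot _))

lemma IdentDistribSeq.rexp_tailRamp {X : ℕ → Ω → ℝ} (hid : S.IdentDistribSeq X)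
    (hX : ∀ n, X n ∈ S.H) (l : ℝ) (n : ℕ) :
    S.rexp (fun ω => tailRamp l (X n ω)) = S.rexp fun ω => tailRamp l (X 0 ω) :=
  hid.rexp_eq hX zero_le_one (abs_tailRamp_sub_le l) (K := 1) (fun x => by
    rw [abs_of_nonneg (tailRamp_nonneg _ _)]; exact tailRamp_le_one _ _) n

/-- Together with `capacity_le_rexp_tailRamp`, this trades capacities of tails for ramp
expectations, which identical distribution carries from one variable to another; it does not speak
of capacities directly. -/
lemma rexp_tailRamp_le_capacity {X : Ω → ℝ} (hX : X ∈ S.H) (l : ℝ) :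
    ENNReal.ofReal (S.rexp fun ω => tailRamp l (X ω)) ≤ S.capacity {ω | l - 1 ≤ |X ω|} := by
  refine rexp_le_capacity (finExp_tailRamp hX l) fun ω => ?_
  by_cases h : l - 1 ≤ |X ω|
  · rw [Set.indicator_of_mem (by exact h)]
    exact tailRamp_le_one _ _
  · rw [tailRamp_eq_zero (not_le.1 h).le]
    exact Set.indicator_nonneg (fun _ _ => zero_le_one) _

lemma capacity_le_rexp_tailRamp {X : Ω → ℝ} (hX : X ∈ S.H) (l : ℝ) :
    S.capacity {ω | l ≤ |X ω|} ≤ ENNReal.ofReal (S.rexp fun ω => tailRamp l (X ω)) :=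
  capacity_le_rexp (finExp_tailRamp hX l) (fun _ => tailRamp_nonneg _ _)
    fun _ h => (tailRamp_eq_one h).ge

end SublinearSpace

/-! ### The converse half: independent variables. -/

lemma abs_prod_sub_prod_le (n : ℕ) {a b : ℕ → ℝ} (ha0 : ∀ i, 0 ≤ a i) (ha1 : ∀ i, a i ≤ 1)
    (hb0 : ∀ i, 0 ≤ b i) (hb1 : ∀ i, b i ≤ 1) :
    |∏ i ∈ Finset.range n, a i - ∏ i ∈ Finset.range n, b i| ≤
      ∑ i ∈ Finset.range n, |a i - b i| := by
  induction n with
  | zero => simp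
  | succ n ih =>
    rw [Finset.prod_range_succ, Finset.prod_range_succ, Finset.sum_range_succ]
    set A := ∏ i ∈ Finset.range n, a i
    set B := ∏ i ∈ Finset.range n, b i
    have hB0 : 0 ≤ B := Finset.prod_nonneg fun i _ => hb0 i
    have hB1 : B ≤ 1 := Finset.prod_le_one (fun i _ => hb0 i) fun i _ => hb1 i
    calc |A * a n - B * b n| = |(A - B) * a n + B * (a n - b n)| := by ring_nf
      _ ≤ |A - B| * a n + B * |a n - b n| := by
        refine (abs_add_le _ _).trans_eq ?_
        rw [abs_mul, abs_mul, abs_of_nonneg (ha0 n), abs_of_nonneg hB0]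
      _ ≤ |A - B| * 1 + 1 * |a n - b n| := by gcongr; exact ha1 n
      _ ≤ _ := by linarith

/-- The event that `|X i| ≥ M (i + 1)` for some `i ≥ M`. -/
def largeValueEvent {Ω : Type*} (X : ℕ → Ω → ℝ) (M : ℕ) : Set Ω :=
  ⋃ i : ℕ, ⋃ _ : M ≤ i, {ω | (M : ℝ) * (i + 1) ≤ |X i ω|}

/-- If `|S_n| < K n` for all large `n`, then `|X i| ≤ |S_(i+1)| + |S_i| < K (2 i + 1)`, which
contradicts `|X i| ≥ M (i + 1)` once `M > 2 |K|`. -/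
lemma limsup_absPartialAverage_of_mem_largeValueEvent {Ω : Type*} {X : ℕ → Ω → ℝ} {ω : Ω}
    (h : ∀ M, ω ∈ largeValueEvent X M) :
    limsup (fun n => absPartialAverage X n ω) atTop = ⊤ := by
  by_contra hne
  obtain ⟨K, hK1, -⟩ := EReal.lt_iff_exists_real_btwn.1 (lt_top_iff_ne_top.2 hne)
  obtain ⟨N, hN⟩ := eventually_atTop.1 (eventually_lt_of_limsup_lt hK1)
  have hS : ∀ n ≥ N, 0 < n → |∑ k ∈ Finset.range n, X k ω| < K * n := fun n hn hpos => by
    have := EReal.coe_lt_coe_iff.1 (hN n hn)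
    rwa [div_lt_iff₀ (by exact_mod_cast hpos)] at this
  obtain ⟨M, hM⟩ := exists_nat_gt (2 * |K|)
  -- `N + 1` rather than `N` keeps `i` positive, as the bound on `S_i` requires.
  obtain ⟨i, hi, hle⟩ := Set.mem_iUnion₂.1 (h (max M (N + 1)))
  have hi1 : N + 1 ≤ i := (le_max_right _ _).trans hi
  have s1 := hS (i + 1) (by omega) (by omega)
  have s2 := hS i (by omega) (by omega)
  rw [Finset.sum_range_succ] at s1
  have hle' : (max M (N + 1) : ℕ) * ((i : ℝ) + 1) ≤ |X i ω| := hle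
  have hMM : (M : ℝ) ≤ (max M (N + 1) : ℕ) := by exact_mod_cast le_max_left _ _
  have hi0 : (0 : ℝ) ≤ i := i.cast_nonneg
  have t1 : |X i ω| ≤ |∑ k ∈ Finset.range i, X k ω + X i ω| + |∑ k ∈ Finset.range i, X k ω| := by
    have := abs_sub (∑ k ∈ Finset.range i, X k ω + X i ω) (∑ k ∈ Finset.range i, X k ω)
    rwa [add_sub_cancel_left] at this
  push_cast at s1
  have hKK := le_abs_self K
  have hK0 := abs_nonneg K
  nlinarith

namespace SublinearSpace

variable {Ω : Type*} [MeasurableSpace Ω] {S : SublinearSpace Ω}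

/-- The upper expectation of minus a product of functions of independent variables. -/
lemma IndepSeq.rexp_neg_prod {X : ℕ → Ω → ℝ} (hind : S.IndepSeq X) (hX : ∀ n, X n ∈ S.H)
    {ξ : ℕ → ℝ → ℝ} (h0 : ∀ i x, 0 ≤ ξ i x) (h1 : ∀ i x, ξ i x ≤ 1)
    (hl : ∀ i x y, |ξ i x - ξ i y| ≤ 1 * |x - y|) (n : ℕ) :
    S.FinExp (fun ω => - ∏ i ∈ Finset.range n, (1 - ξ i (X i ω))) ∧
    S.rexp (fun ω => - ∏ i ∈ Finset.range n, (1 - ξ i (X i ω))) =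
      - ∏ i ∈ Finset.range n, (1 - S.rexp fun ω => ξ i (X i ω)) := by
  set f : ℕ → (ℕ → ℝ) → ℝ := fun n x => ∏ i ∈ Finset.range n, (1 - ξ i (x i)) with hf
  have hs0 : ∀ i x, 0 ≤ 1 - ξ i x := fun i x => sub_nonneg.2 (h1 i x)
  have hs1 : ∀ i x, 1 - ξ i x ≤ 1 := fun i x => sub_le_self _ (h0 i x)
  have hfl : ∀ n, LipFirst n (f n) := fun n => ⟨1, zero_le_one, fun x y => by
    refine (abs_prod_sub_prod_le n (fun i => hs0 i _) (fun i => hs1 i _) (fun i => hs0 i _)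
      (fun i => hs1 i _)).trans ?_
    rw [one_mul]
    refine Finset.sum_le_sum fun j _ => ?_
    rw [sub_sub_sub_cancel_left, abs_sub_comm, ← one_mul |x j - y j|]
    exact hl j _ _⟩
  have hf0 : ∀ n x, 0 ≤ f n x := fun n x => Finset.prod_nonneg fun i _ => hs0 i _
  have hf1 : ∀ n x, f n x ≤ 1 := fun n x =>
    Finset.prod_le_one (fun i _ => hs0 i _) fun i _ => hs1 i _
  have hfe : ∀ n, S.FinExp fun ω => f n fun j => X j ω := fun n =>
    .of_bdd (S.comp_lipFirst_mem (hfl n) hX) (C := 1) fun ω => by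
      rw [abs_of_nonneg (hf0 _ _)]; exact hf1 _ _
  have hξe : ∀ i, S.FinExp fun ω => ξ i (X i ω) := fun i =>
    .of_bdd (S.comp_lip_mem zero_le_one (hl i) (hX i)) (C := 1) fun ω => by
      rw [abs_of_nonneg (h0 _ _)]; exact h1 _ _
  refine ⟨(hfe n).neg, ?_⟩
  induction n with
  | zero => simp [S.rexp_const]
  | succ n ih =>
    rw [Finset.prod_range_succ, neg_mul_eq_neg_mul, ← ih]
    -- The first factor has no predecessors, so independence says nothing about it; it is computed
    -- directly.
    rcases n with _ | n
    · have e : (fun ω => -∏ i ∈ Finset.range (0 + 1), (1 - ξ i (X i ω))) =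
          fun ω => ξ 0 (X 0 ω) - 1 := by ext; simp
      rw [e, rexp_sub_const (hξe 0)]
      simp [S.rexp_const]
    -- Minus the product is written as `f * (ξ - 1)` with `f ≥ 0`, so that with the past frozen `f`
    -- leaves the inner expectation by positive homogeneity.
    set φ : (Fin (n + 1) → ℝ) × (Fin 1 → ℝ) → ℝ :=
      fun p => f (n + 1) (extendZero p.1) * (ξ (n + 1) (p.2 0) - 1) with hφ
    have hφl : LocLip φ := by
      obtain ⟨C, hC, hCf⟩ := (hfl (n + 1)).bound_extendZero
      refine locLip_of_lip (C := C + 1) (by linarith) fun p q => ?_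
      have a1 : ‖p.1 - q.1‖ ≤ ‖p - q‖ := norm_fst_le (p - q)
      have a2 : |p.2 0 - q.2 0| ≤ ‖p - q‖ :=
        (norm_le_pi_norm (p.2 - q.2) 0).trans (norm_snd_le (p - q))
      have a3 := hCf p.1 q.1
      have a4 := hl (n + 1) (p.2 0) (q.2 0)
      calc |φ p - φ q| = |(f (n + 1) (extendZero p.1) - f (n + 1) (extendZero q.1)) *
              (ξ (n + 1) (p.2 0) - 1) + f (n + 1) (extendZero q.1) *
                (ξ (n + 1) (p.2 0) - ξ (n + 1) (q.2 0))| := by rw [hφ]; ring_nf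
        _ ≤ |f (n + 1) (extendZero p.1) - f (n + 1) (extendZero q.1)| *
              |ξ (n + 1) (p.2 0) - 1| + |f (n + 1) (extendZero q.1)| *
                |ξ (n + 1) (p.2 0) - ξ (n + 1) (q.2 0)| := by
            rw [← abs_mul, ← abs_mul]; exact abs_add_le _ _
        _ ≤ (C * ‖p - q‖) * 1 + 1 * ‖p - q‖ := by
            gcongr
            · exact a3.trans (by gcongr)
            · rw [abs_sub_comm, abs_of_nonneg (hs0 _ _)]; exact hs1 _ _
            · rw [abs_of_nonneg (hf0 _ _)]; exact hf1 _ _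
            · linarith
        _ = (C + 1) * ‖p - q‖ := by ring
    set Y := X (n + 1) with hY
    have hYe := hξe (n + 1)
    have hYm : S.FinExp fun ω => ξ (n + 1) (Y ω) - 1 := hYe.sub (S.finExp_const 1)
    have hYp : S.FinExp fun ω => 1 - ξ (n + 1) (Y ω) := (S.finExp_const 1).sub hYe
    have e1 : ∀ u : Fin (n + 1) → ℝ, (fun ω' => |φ (u, fun _ => Y ω')|) =
        fun ω' => f (n + 1) (extendZero u) * (1 - ξ (n + 1) (Y ω')) := fun u => by
      ext ω'
      rw [hφ, abs_mul, abs_of_nonneg (hf0 _ _), abs_sub_comm, abs_of_nonneg (hs0 _ _)]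
    have e2 : ∀ ω, f (n + 1) (extendZero fun i : Fin (n + 1) => X i ω) =
        f (n + 1) fun j => X j ω := fun ω =>
      (hfl (n + 1)).extendZero_eq fun j => X j ω
    have e3 : ∀ u : Fin (n + 1) → ℝ, S.rexp (fun ω' => |φ (u, fun _ => Y ω')|) =
        f (n + 1) (extendZero u) * S.rexp fun ω' => 1 - ξ (n + 1) (Y ω') := fun u => by
      rw [e1, rexp_smul hYp.1 (hf0 _ _)]
    have e4 : ∀ u : Fin (n + 1) → ℝ, S.rexp (fun ω' => φ (u, fun _ => Y ω')) =
        f (n + 1) (extendZero u) * S.rexp fun ω' => ξ (n + 1) (Y ω') - 1 := fun u => by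
      rw [← rexp_smul hYm.1 (hf0 _ _)]
    -- Both inner expectations are constant multiples of `f`, hence belong to `H`, as `IndepTo`
    -- demands.
    have m3 : S.FinExp fun ω => S.rexp (fun ω' => |φ (fun i => X i ω, fun _ => Y ω')|) := by
      simp only [e3, e2]
      simpa only [mul_comm] using (hfe (n + 1)).smul (S.rexp fun ω' => 1 - ξ (n + 1) (Y ω'))
    have m4 : S.FinExp fun ω => S.rexp (fun ω' => φ (fun i => X i ω, fun _ => Y ω')) := by
      simp only [e4, e2]
      simpa only [mul_comm] using (hfe (n + 1)).smul (S.rexp fun ω' => ξ (n + 1) (Y ω') - 1)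
    have key := hind n φ hφl (fun u => by
      rw [e1, ← (hYp.smul _).coe_rexp]; exact EReal.coe_lt_top _) m3.1 m3.2 m4.1
    have key' : S.rexp (fun ω => φ (fun i => X i ω, fun _ => Y ω)) =
        S.rexp fun ω => S.rexp fun ω' => φ (fun i => X i ω, fun _ => Y ω') :=
      congrArg EReal.toReal key
    have e5 : (fun ω => φ (fun i => X i ω, fun _ => Y ω)) =
        fun ω => -∏ i ∈ Finset.range (n + 1 + 1), (1 - ξ i (X i ω)) := by
      ext ω
      rw [Finset.prod_range_succ]
      simp only [hφ]
      rw [e2, ← neg_sub, mul_neg]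
    rw [e5] at key'
    rw [key']
    simp only [e4, e2]
    -- The sign needed to pull the constant out of the outer expectation of `-f`.
    have hc : 0 ≤ 1 - S.rexp fun ω => ξ (n + 1) (Y ω) :=
      sub_nonneg.2 (rexp_le_of_le hYe fun ω => h1 _ _)
    have e6 : (fun ω => (f (n + 1) fun j => X j ω) * S.rexp fun ω' => ξ (n + 1) (Y ω') - 1) =
        fun ω => (1 - S.rexp fun ω => ξ (n + 1) (Y ω)) * -(f (n + 1) fun j => X j ω) := by
      ext ω
      rw [rexp_sub_const hYe]
      ring
    rw [e6, rexp_smul (hfe _).neg.1 hc, mul_comm]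

/-- Convergence would bound the Choquet integral by a convergent series of tails at multiples of `M
+ 1`. -/
lemma tendsto_sum_rexp_tailRamp {X : Ω → ℝ} (hX : X ∈ S.H)
    (hC : ∫⁻ t in Set.Ioi (0 : ℝ), S.capacity {ω | t ≤ |X ω|} = ⊤) (M : ℕ) :
    Tendsto (fun n => ∑ i ∈ Finset.range n,
      if i < M then 0 else S.rexp fun ω => tailRamp ((M : ℝ) * (i + 1) + 1) (X ω)) atTop atTop := by
  set v : ℝ → ℝ := fun l => S.rexp fun ω => tailRamp l (X ω) with hv
  have hv0 : ∀ l, 0 ≤ v l := fun l =>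
    rexp_nonneg (finExp_tailRamp hX l) fun _ => tailRamp_nonneg _ _
  set u : ℕ → ℝ := fun i => if i < M then 0 else v ((M : ℝ) * (i + 1) + 1) with hu
  have hu0 : ∀ i, 0 ≤ u i := fun i => by
    simp only [hu]; split_ifs
    exacts [le_rfl, hv0 _]
  rw [← not_summable_iff_tendsto_nat_atTop_of_nonneg hu0]
  intro hs
  have hs2 : Summable fun i : ℕ => v ((M : ℝ) * (i + 1) + 1) := by
    rw [← summable_nat_add_iff M]
    refine ((summable_nat_add_iff M).2 hs).congr fun i => ?_
    simp [hu]
  set c : ℝ := M + 1 with hc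
  have hcpos : 0 < c := by positivity
  -- Ramps decrease in the level, and `M (i + 1) + 1 ≤ (M + 1) (i + 1)`.
  have hs3 : Summable fun i : ℕ => v (c * ((i + 1 : ℕ) : ℝ)) := by
    refine Summable.of_nonneg_of_le (fun i => hv0 _) (fun i => ?_) hs2
    refine rexp_mono (finExp_tailRamp hX _) (finExp_tailRamp hX _) fun ω => ?_
    refine max_le_max le_rfl (min_le_min le_rfl ?_)
    have : (0 : ℝ) ≤ i := i.cast_nonneg
    push_cast
    linarith
  have hs4 : Summable fun i : ℕ => v (c * i) := (summable_nat_add_iff 1).1 hs3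
  have h1 := lintegral_Ioi_le_tsum_mul (S.antitone_capacity_ge fun ω => |X ω|) hcpos
  rw [hC, top_le_iff, ENNReal.tsum_mul_right] at h1
  refine ENNReal.mul_ne_top (ne_top_of_le_ne_top hs4.tsum_ofReal_ne_top ?_)
    ENNReal.ofReal_ne_top h1
  exact ENNReal.tsum_le_tsum fun n => capacity_le_rexp_tailRamp hX _

lemma one_le_outerCapacity_largeValueEvent {X : ℕ → Ω → ℝ} (hind : S.IndepSeq X)
    (hX : ∀ n, X n ∈ S.H) (hid : S.IdentDistribSeq X) (hS : S.CountablySubadditive)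
    (hC : ∫⁻ t in Set.Ioi (0 : ℝ), S.capacity {ω | t ≤ |X 0 ω|} = ⊤) (M : ℕ) :
    1 ≤ S.outerCapacity (largeValueEvent X M) := by
  -- The extra `1` in the level makes the ramp vanish when `|x| ≤ M (i + 1)`, so `1 - ∏ (1 - ξ i)`
  -- is `0` off the event.
  set ξ : ℕ → ℝ → ℝ := fun i x => if i < M then 0 else tailRamp ((M : ℝ) * (i + 1) + 1) x with hξ
  have h0 : ∀ i x, 0 ≤ ξ i x := fun i x => by
    simp only [hξ]; split_ifs
    exacts [le_rfl, tailRamp_nonneg _ _]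
  have h1 : ∀ i x, ξ i x ≤ 1 := fun i x => by
    simp only [hξ]; split_ifs
    exacts [zero_le_one, tailRamp_le_one _ _]
  have hl : ∀ i x y, |ξ i x - ξ i y| ≤ 1 * |x - y| := fun i x y => by
    simp only [hξ]; split_ifs
    exacts [by simp, abs_tailRamp_sub_le _ _ _]
  have hval : ∀ i, (S.rexp fun ω => ξ i (X i ω)) =
      if i < M then 0 else S.rexp fun ω => tailRamp ((M : ℝ) * (i + 1) + 1) (X 0 ω) := fun i => by
    simp only [hξ]; split_ifs
    exacts [S.rexp_const 0, hid.rexp_tailRamp hX _ _]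
  have hbound : ∀ n, ENNReal.ofReal (1 - Real.exp (-∑ i ∈ Finset.range n,
      if i < M then 0 else S.rexp fun ω => tailRamp ((M : ℝ) * (i + 1) + 1) (X 0 ω))) ≤
        S.outerCapacity (largeValueEvent X M) := by
    intro n
    obtain ⟨hfe, hprod⟩ := hind.rexp_neg_prod hX h0 h1 hl n
    have hle : ∀ ω, ∏ i ∈ Finset.range n, (1 - ξ i (X i ω)) ≤ 1 := fun ω =>
      Finset.prod_le_one (fun i _ => sub_nonneg.2 (h1 i _)) fun i _ => sub_le_self _ (h0 i _)
    have hge : ∀ ω, 0 ≤ ∏ i ∈ Finset.range n, (1 - ξ i (X i ω)) := fun ω =>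
      Finset.prod_nonneg fun i _ => sub_nonneg.2 (h1 i _)
    refine le_trans ?_ (hS.rexp_le_outerCapacity (hfe.add (S.finExp_const 1))
      (fun ω => by linarith [hle ω]) fun ω => ?_)
    · refine ENNReal.ofReal_le_ofReal ?_
      rw [rexp_add_const hfe, hprod]
      have : ∏ i ∈ Finset.range n, (1 - S.rexp fun ω => ξ i (X i ω)) ≤
          Real.exp (-∑ i ∈ Finset.range n, S.rexp fun ω => ξ i (X i ω)) := by
        rw [← Finset.sum_neg_distrib, Real.exp_sum]
        refine Finset.prod_le_prod (fun i _ => sub_nonneg.2 ?_) fun i _ => ?_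
        · exact rexp_le_of_le (.of_bdd (S.comp_lip_mem zero_le_one (hl i) (hX i)) (C := 1)
            fun ω => by rw [abs_of_nonneg (h0 _ _)]; exact h1 _ _) fun ω => h1 _ _
        · exact Real.one_sub_le_exp_neg _
      simp only [hval] at this ⊢
      linarith
    · by_cases hω : ω ∈ largeValueEvent X M
      · rw [Set.indicator_of_mem hω]
        linarith [hge ω]
      · rw [Set.indicator_of_notMem hω, Finset.prod_eq_one, neg_add_cancel]
        intro i _
        simp only [hξ]
        split_ifs with hi
        · simp
        · rw [tailRamp_eq_zero, sub_zero]
          have : ¬ (M : ℝ) * (i + 1) ≤ |X i ω| := fun h =>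
            hω (Set.mem_iUnion₂.2 ⟨i, not_lt.1 hi, h⟩)
          linarith
  have hlim : Tendsto (fun n => ENNReal.ofReal (1 - Real.exp (-∑ i ∈ Finset.range n,
      if i < M then 0 else S.rexp fun ω => tailRamp ((M : ℝ) * (i + 1) + 1) (X 0 ω))))
        atTop (𝓝 1) := by
    have := (Real.tendsto_exp_neg_atTop_nhds_zero.comp
      (tendsto_sum_rexp_tailRamp (hX 0) hC M)).const_sub 1
    rw [sub_zero] at this
    simpa using ENNReal.tendsto_ofReal this
  exact le_of_tendsto' hlim hbound

/-- The converse part of the strong law: if the averages of independent identically distributed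
variables are not almost surely unbounded, the Choquet integral of the modulus is finite. -/
theorem choquet_lt_top_of_outerCapacity_lt_one {X : ℕ → Ω → ℝ} (hX : ∀ n, X n ∈ S.H)
    (hid : S.IdentDistribSeq X) (hind : S.IndepSeq X) (hcont : ContinuousCapacity S.outerCapacity)
    (hS : S.CountablySubadditive)
    (hlt : S.outerCapacity {ω | limsup (fun n => absPartialAverage X n ω) atTop = ⊤} < 1) :
    choquet S.capacity (fun ω => |X 0 ω|) < ⊤ := by
  rw [S.choquet_lt_top_iff fun ω => abs_nonneg _, lt_top_iff_ne_top]
  intro hC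
  have hmeas : ∀ M, MeasurableSet (largeValueEvent X M) := fun M =>
    .iUnion fun i => .iUnion fun _ =>
      measurableSet_le measurable_const (S.measurable_of_mem _ (hX i)).abs
  have hanti : Antitone (largeValueEvent X) := fun M M' h =>
    Set.iUnion_mono fun i => Set.iUnion_subset fun hi => by
      refine Set.subset_iUnion_of_subset (h.trans hi) fun ω hω => ?_
      have hω' : (M' : ℝ) * (i + 1) ≤ |X i ω| := hω
      change (M : ℝ) * (i + 1) ≤ |X i ω|
      refine le_trans ?_ hω'
      gcongr
  have h1 : 1 ≤ S.outerCapacity (⋂ M, largeValueEvent X M) :=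
    ge_of_tendsto' (hcont.2 _ hmeas hanti) fun M =>
      one_le_outerCapacity_largeValueEvent hind hX hid hS hC M
  refine (h1.trans ?_).not_gt hlt
  rw [← S.capacityOuterMeasure_apply, ← S.capacityOuterMeasure_apply]
  exact measure_mono fun ω hω =>
    limsup_absPartialAverage_of_mem_largeValueEvent (Set.mem_iInter.1 hω)

end SublinearSpace

/-! ### Maximal suffix sums and their second moments. -/

/-- The maximum of `0` and of the sums of `z i` over `k ≤ i < n`, for `k < n`. -/
noncomputable def suffixMax (z : ℕ → ℝ) : ℕ → ℝ
  | 0 => 0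
  | n + 1 => max (suffixMax z n + z n) 0

lemma suffixMax_nonneg (z : ℕ → ℝ) : ∀ n, 0 ≤ suffixMax z n
  | 0 => le_rfl
  | _ + 1 => le_max_right _ _

lemma suffixMax_le_sum_abs (z : ℕ → ℝ) (n : ℕ) :
    suffixMax z n ≤ ∑ i ∈ Finset.range n, |z i| := by
  induction n with
  | zero => simp [suffixMax]
  | succ n ih =>
    rw [Finset.sum_range_succ, suffixMax]
    exact max_le (add_le_add ih (le_abs_self _)) (by positivity)

lemma abs_suffixMax_sub_le (z z' : ℕ → ℝ) (n : ℕ) :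
    |suffixMax z n - suffixMax z' n| ≤ ∑ i ∈ Finset.range n, |z i - z' i| := by
  induction n with
  | zero => simp [suffixMax]
  | succ n ih =>
    rw [Finset.sum_range_succ, suffixMax, suffixMax]
    refine (abs_max_sub_max_le_abs _ _ _).trans ?_
    rw [add_sub_add_comm]
    exact (abs_add_le _ _).trans (by gcongr)

lemma suffixMax_mono {z z' : ℕ → ℝ} (h : ∀ i, z i ≤ z' i) (n : ℕ) :
    suffixMax z n ≤ suffixMax z' n := by
  induction n with
  | zero => exact le_rfl
  | succ n ih => exact max_le_max (add_le_add ih (h n)) le_rfl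

lemma sum_Ico_le_suffixMax (z : ℕ → ℝ) {k n : ℕ} (h : k ≤ n) :
    ∑ i ∈ Finset.Ico k n, z i ≤ suffixMax z n := by
  induction n, h using Nat.le_induction with
  | base => simpa using suffixMax_nonneg z k
  | succ n hkn ih =>
    rw [Finset.sum_Ico_succ_top hkn, suffixMax]
    exact le_max_of_le_left (by gcongr)

lemma sq_suffixMax_succ_le (z : ℕ → ℝ) (n : ℕ) :
    suffixMax z (n + 1) ^ 2 ≤ suffixMax z n ^ 2 + 2 * (suffixMax z n * z n) + z n ^ 2 := by
  rw [suffixMax]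
  rcases max_cases (suffixMax z n + z n) 0 with ⟨h, -⟩ | ⟨h, -⟩ <;> rw [h] <;>
    nlinarith [sq_nonneg (suffixMax z n + z n)]

lemma extendZero_mono {n : ℕ} {v w : Fin n → ℝ} (h : v ≤ w) (j : ℕ) :
    extendZero v j ≤ extendZero w j := by
  unfold extendZero
  split_ifs with hj
  exacts [h _, le_rfl]

namespace SublinearSpace

variable {Ω : Type*} [MeasurableSpace Ω] {S : SublinearSpace Ω}

lemma FinExp.mul_of_bdd {X Y : Ω → ℝ} (hX : X ∈ S.H) (hY : Y ∈ S.H) {a b : ℝ}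
    (ha : ∀ ω, |X ω| ≤ a) (hb : ∀ ω, |Y ω| ≤ b) : S.FinExp fun ω => X ω * Y ω :=
  .of_bdd (S.mul_mem hX hY) (C := a * b) fun ω => by
    rw [abs_mul]
    exact mul_le_mul (ha ω) (hb ω) (abs_nonneg _) ((abs_nonneg _).trans (ha ω))

/-- Negative dependence with `E[g] = 0`: the bound `E[f] E[g]` is zero, and the condition `0 ≤ E[g]`
just holds. -/
lemma NegDepSeq.rexp_mul_le_zero {X : ℕ → Ω → ℝ} (hneg : S.NegDepSeq X) (hX : ∀ n, X n ∈ S.H)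
    {i : ℕ} {f : (ℕ → ℝ) → ℝ} (hf : LipFirst (i + 1) f) (hf0 : ∀ x, 0 ≤ f x) {a : ℝ}
    (hfa : ∀ x, f x ≤ a) (hfm : Monotone f) {g : ℝ → ℝ} {C b : ℝ} (hC : 0 ≤ C)
    (hg : ∀ x y, |g x - g y| ≤ C * |x - y|) (hgb : ∀ x, |g x| ≤ b) (hgm : Monotone g)
    (hE : S.rexp (fun ω => g (X (i + 1) ω)) = 0) :
    S.rexp (fun ω => (f fun j => X j ω) * g (X (i + 1) ω)) ≤ 0 := by
  have hfa' : ∀ x, |f x| ≤ a := fun x => by rw [abs_of_nonneg (hf0 x)]; exact hfa x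
  have e : ∀ ω, f (extendZero fun j : Fin (i + 1) => X j ω) = f fun j => X j ω := fun ω =>
    hf.extendZero_eq fun j => X j ω
  have hfX := S.comp_lipFirst_mem hf hX
  have hgX := S.comp_lip_mem hC hg (hX (i + 1))
  have hgF : S.FinExp fun ω => g (X (i + 1) ω) := .of_bdd hgX fun ω => hgb _
  have hmul := FinExp.mul_of_bdd hfX hgX (fun ω => hfa' _) (fun ω => hgb _)
  have hE' : S.exp (fun ω => g (X (i + 1) ω)) = 0 := by
    rw [← hgF.coe_rexp, hE, EReal.coe_zero]
  have key := hneg i (fun v => f (extendZero v)) (fun v => g (v 0)) hf.locLip_extendZero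
    (locLip_eval_zero hC hg) (fun ω => hf0 _) hE'.ge
  simp only [e] at key
  have key' := key hmul.2 (FinExp.of_bdd hfX fun ω => hfa' _).2 hgF.2
    (Or.inl ⟨fun v w h => hfm (extendZero_mono h), fun v w h => hgm (h 0)⟩)
  rw [hE', mul_zero, ← hmul.coe_rexp] at key'
  exact_mod_cast key'

/-- The second moment of the maximal suffix sum of centered negatively dependent variables. -/
lemma NegDepSeq.rexp_sq_suffixMax_le {X : ℕ → Ω → ℝ} (hneg : S.NegDepSeq X)
    (hX : ∀ n, X n ∈ S.H) {Z : ℕ → ℝ → ℝ} (hZl : ∀ i x y, |Z i x - Z i y| ≤ 1 * |x - y|)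
    {K : ℕ → ℝ} (hZK : ∀ i x, |Z i x| ≤ K i) (hZm : ∀ i, Monotone (Z i))
    (hE : ∀ i, S.rexp (fun ω => Z i (X i ω)) = 0) (n : ℕ) :
    S.FinExp (fun ω => suffixMax (fun i => Z i (X i ω)) n ^ 2) ∧
    S.rexp (fun ω => suffixMax (fun i => Z i (X i ω)) n ^ 2) ≤
      ∑ i ∈ Finset.range n, S.rexp fun ω => Z i (X i ω) ^ 2 := by
  have hl : ∀ n, LipFirst n fun x : ℕ → ℝ => suffixMax (fun i => Z i (x i)) n := fun n =>
    ⟨1, zero_le_one, fun x y => (abs_suffixMax_sub_le _ _ n).trans <| by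
      rw [one_mul]
      exact Finset.sum_le_sum fun i _ => (hZl i _ _).trans_eq (one_mul _)⟩
  have hb : ∀ n (x : ℕ → ℝ), suffixMax (fun i => Z i (x i)) n ≤ ∑ i ∈ Finset.range n, K i := fun n x =>
    (suffixMax_le_sum_abs _ n).trans (Finset.sum_le_sum fun i _ => hZK i _)
  have hm : ∀ n, Monotone fun x : ℕ → ℝ => suffixMax (fun i => Z i (x i)) n := fun n x y h =>
    suffixMax_mono (fun i => hZm i (h i)) n
  have hW := fun n => S.comp_lipFirst_mem (hl n) hX
  have hZ := fun i => S.comp_lip_mem zero_le_one (hZl i) (hX i)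
  have hWb : ∀ n ω, |suffixMax (fun i => Z i (X i ω)) n| ≤ ∑ i ∈ Finset.range n, K i :=
    fun n ω => by rw [abs_of_nonneg (suffixMax_nonneg _ _)]; exact hb n fun i => X i ω
  have hW2 : ∀ n, S.FinExp fun ω => suffixMax (fun i => Z i (X i ω)) n ^ 2 := fun n => by
    simpa only [pow_two] using FinExp.mul_of_bdd (hW n) (hW n) (hWb n) (hWb n)
  have hZ2 : ∀ i, S.FinExp fun ω => Z i (X i ω) ^ 2 := fun i => by
    simpa only [pow_two] using
      FinExp.mul_of_bdd (hZ i) (hZ i) (fun ω => hZK i _) (fun ω => hZK i _)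
  have hWZ : ∀ n, S.FinExp fun ω => suffixMax (fun i => Z i (X i ω)) n * Z n (X n ω) := fun n =>
    FinExp.mul_of_bdd (hW n) (hZ n) (hWb n) fun ω => hZK n _
  refine ⟨hW2 n, ?_⟩
  induction n with
  | zero => simp [suffixMax, S.rexp_const]
  | succ n ih =>
    have hcross : S.rexp (fun ω => suffixMax (fun i => Z i (X i ω)) n * Z n (X n ω)) ≤ 0 := by
      -- The suffix maximum of no terms is `0`, so no dependence is needed for the first variable.
      rcases n with _ | i
      · simp [suffixMax, S.rexp_const]
      · exact hneg.rexp_mul_le_zero hX (hl (i + 1)) (fun x => suffixMax_nonneg _ _) (hb (i + 1))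
          (hm (i + 1)) zero_le_one (hZl (i + 1)) (hZK (i + 1)) (hZm (i + 1)) (hE (i + 1))
    have h1 := rexp_mono (hW2 (n + 1)) (((hW2 n).add ((hWZ n).smul 2)).add (hZ2 n))
      fun ω => sq_suffixMax_succ_le _ n
    have h2 := rexp_add_le ((hW2 n).add ((hWZ n).smul 2)) (hZ2 n)
    have h3 := rexp_add_le (hW2 n) ((hWZ n).smul 2)
    rw [rexp_smul (hWZ n).1 zero_le_two] at h3
    rw [Finset.sum_range_succ]
    linarith

end SublinearSpace

/-! ### Truncation and summability along geometric sequences. -/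

/-- Truncation of a real number to `[-b, b]`. -/
noncomputable def truncAt (b x : ℝ) : ℝ := max (-b) (min b x)

lemma truncAt_mono (b : ℝ) : Monotone (truncAt b) := fun _ _ h =>
  max_le_max le_rfl (min_le_min le_rfl h)

lemma abs_truncAt_sub_le (b x y : ℝ) : |truncAt b x - truncAt b y| ≤ 1 * |x - y| := by
  rw [one_mul, truncAt, truncAt]
  refine (abs_max_sub_max_le_max _ _ _ _).trans (max_le (by simp) ?_)
  exact (abs_min_sub_min_le_max _ _ _ _).trans (max_le (by simp) le_rfl)

lemma abs_truncAt_le {b : ℝ} (hb : 0 ≤ b) (x : ℝ) : |truncAt b x| ≤ b :=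
  abs_le.2 ⟨le_max_left _ _, max_le (by linarith) (min_le_left _ _)⟩

lemma truncAt_eq_self {b x : ℝ} (h : |x| ≤ b) : truncAt b x = x := by
  rw [truncAt, min_eq_right (abs_le.1 h).2, max_eq_right (abs_le.1 h).1]

lemma truncAt_neg {b : ℝ} (hb : 0 ≤ b) (x : ℝ) : truncAt b (-x) = - truncAt b x := by
  simp only [truncAt, max_def, min_def]
  split_ifs <;> linarith

lemma abs_sub_truncAt_le {b : ℝ} (hb : 0 ≤ b) (x : ℝ) : |x - truncAt b x| ≤ max (|x| - b) 0 := by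
  rcases le_total |x| b with h | h
  · simp [truncAt_eq_self h]
  · rcases abs_cases x with ⟨hx, h0⟩ | ⟨hx, h0⟩ <;> rw [hx] at h ⊢
    · rw [truncAt, min_eq_left h, max_eq_right (by linarith), abs_of_nonneg (by linarith)]
      exact le_max_left _ _
    · rw [truncAt, min_eq_right (by linarith), max_eq_left (by linarith),
        abs_of_nonpos (by linarith)]
      exact le_max_of_le_left (by linarith)

lemma abs_truncAt_le_min {b : ℝ} (hb : 0 ≤ b) (x : ℝ) : |truncAt b x| ≤ min |x| b := by
  rcases le_total |x| b with h | h
  · rw [truncAt_eq_self h, min_eq_left h]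
  · rw [min_eq_right h]
    exact abs_truncAt_le hb x

/-- Telescoping of squares, `2 l + 1 = (l + 1)^2 - l^2`, with the ramp above the indicator of `l ≤
|x|`. -/
lemma sq_min_le_sum_tailRamp (x : ℝ) (m : ℕ) :
    min |x| m ^ 2 ≤ ∑ l ∈ Finset.range m, (2 * (l : ℝ) + 1) * tailRamp l x := by
  induction m with
  | zero => simp
  | succ m ih =>
    rw [Finset.sum_range_succ]
    rcases le_total (m : ℝ) |x| with h | h
    · rw [tailRamp_eq_one h]
      rw [min_eq_right h] at ih
      have h1 : min |x| ((m + 1 : ℕ) : ℝ) ≤ m + 1 := (min_le_right _ _).trans_eq (by push_cast; ring)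
      have h2 : 0 ≤ min |x| ((m + 1 : ℕ) : ℝ) := by positivity
      nlinarith
    · rw [min_eq_left (h.trans (by push_cast; linarith))]
      rw [min_eq_left h] at ih
      have := mul_nonneg (by positivity : 0 ≤ 2 * (m : ℝ) + 1) (tailRamp_nonneg m x)
      linarith

lemma sq_truncAt_le_sum_tailRamp (x : ℝ) {i n : ℕ} (h : i < n) :
    truncAt (i + 1) x ^ 2 ≤ ∑ l ∈ Finset.range n, (2 * (l : ℝ) + 1) * tailRamp l x := by
  have h0 : (0 : ℝ) ≤ i + 1 := by positivity
  rw [← sq_abs]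
  refine le_trans ?_ (sq_min_le_sum_tailRamp x n)
  have h1 : (i : ℝ) + 1 ≤ n := by exact_mod_cast h
  gcongr
  exact (abs_truncAt_le_min h0 x).trans (min_le_min le_rfl h1)

/-- If `J` is the first index with `⌊c^J⌋ > l`, then `c^J ≥ l + 1`, and `⌊c^(j+J)⌋ ≥ (1 - c⁻¹) c^j
(l + 1)` leaves a geometric series. -/
lemma tsum_inv_floor_pow_le {c : ℝ} (hc : 1 < c) (l : ℕ) :
    ∑' j : ℕ, ENNReal.ofReal (if l < ⌊c ^ j⌋₊ then ((⌊c ^ j⌋₊ : ℕ) : ℝ)⁻¹ else 0) ≤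
      ENNReal.ofReal ((1 - c⁻¹)⁻¹ / (l + 1)) * ∑' j : ℕ, ENNReal.ofReal (c⁻¹ ^ j) := by
  have hc0 : 0 < c := by linarith
  have hci : 0 < 1 - c⁻¹ := sub_pos.2 (inv_lt_one_of_one_lt₀ hc)
  have hex : ∃ j, l < ⌊c ^ j⌋₊ := by
    obtain ⟨j, hj⟩ := pow_unbounded_of_one_lt ((l : ℝ) + 1) hc
    exact ⟨j, (Nat.le_floor (by push_cast; exact hj.le) : l + 1 ≤ _)⟩
  obtain ⟨J, hspec, hmin⟩ : ∃ J, l < ⌊c ^ J⌋₊ ∧ ∀ j < J, ¬ l < ⌊c ^ j⌋₊ := by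
    classical
    exact ⟨Nat.find hex, Nat.find_spec hex, fun j => Nat.find_min hex⟩
  have hJ : (l : ℝ) + 1 ≤ c ^ J :=
    le_trans (by exact_mod_cast hspec) (Nat.floor_le (pow_nonneg hc0.le J))
  rw [← ENNReal.summable.sum_add_tsum_nat_add' (k := J), Finset.sum_eq_zero, zero_add,
    ← ENNReal.tsum_mul_left]
  · refine ENNReal.tsum_le_tsum fun j => ?_
    rw [← ENNReal.ofReal_mul (by positivity)]
    refine ENNReal.ofReal_le_ofReal ?_
    have hr : 0 ≤ (1 - c⁻¹)⁻¹ / ((l : ℝ) + 1) * c⁻¹ ^ j := by positivity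
    split_ifs
    · have h1 := mul_pow_le_nat_floor_pow hc (j + J)
      have h2 : (1 - c⁻¹) * (c ^ j * (l + 1)) ≤ (⌊c ^ (j + J)⌋₊ : ℕ) := by
        refine le_trans ?_ h1
        rw [pow_add]
        gcongr
      refine (inv_anti₀ (by positivity) h2).trans_eq ?_
      rw [inv_pow]
      field_simp
    · exact hr
  · intro j hj
    rw [if_neg (hmin j (Finset.mem_range.1 hj)), ENNReal.ofReal_zero]

namespace SublinearSpace

variable {Ω : Type*} [MeasurableSpace Ω] {S : SublinearSpace Ω}

lemma finExp_truncAt {X : Ω → ℝ} (hX : X ∈ S.H) {b : ℝ} (hb : 0 ≤ b) :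
    S.FinExp fun ω => truncAt b (X ω) :=
  .of_bdd (S.comp_lip_mem zero_le_one (abs_truncAt_sub_le b) hX) fun _ => abs_truncAt_le hb _

lemma finExp_sq_truncAt {X : Ω → ℝ} (hX : X ∈ S.H) {b : ℝ} (hb : 0 ≤ b) :
    S.FinExp fun ω => truncAt b (X ω) ^ 2 := by
  simpa only [pow_two] using FinExp.mul_of_bdd (finExp_truncAt hX hb).1 (finExp_truncAt hX hb).1
    (fun _ => abs_truncAt_le hb _) (fun _ => abs_truncAt_le hb _)

variable (S) in
/-- The `i`-th variable truncated at `i + 1` and centered by its upper expectation. -/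
noncomputable def centeredTrunc (X : ℕ → Ω → ℝ) (ω : Ω) (i : ℕ) : ℝ :=
  truncAt (i + 1) (X i ω) - S.rexp fun ω => truncAt (i + 1) (X 0 ω)

lemma rexp_sq_truncAt_le {X : Ω → ℝ} (hX : X ∈ S.H) {i n : ℕ} (h : i < n) :
    S.rexp (fun ω => truncAt (i + 1) (X ω) ^ 2) ≤
      ∑ l ∈ Finset.range n, (2 * (l : ℝ) + 1) * S.rexp fun ω => tailRamp l (X ω) := by
  have hF : ∀ l ∈ Finset.range n, S.FinExp fun ω => (2 * (l : ℝ) + 1) * tailRamp l (X ω) :=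
    fun l _ => (finExp_tailRamp hX l).smul _
  refine (rexp_mono (finExp_sq_truncAt hX (by positivity)) (.sum _ hF)
    fun ω => sq_truncAt_le_sum_tailRamp _ h).trans ((rexp_sum_le _ hF).trans_eq ?_)
  exact Finset.sum_congr rfl fun l _ => rexp_smul (finExp_tailRamp hX l).1 (by positivity)

/-- Chebyshev's inequality. All `n` variances get the same bound, that for truncation at `n`; the
factor `4` is the cost of centering. -/
lemma NegDepSeq.capacity_suffixMax_le {X : ℕ → Ω → ℝ} (hneg : S.NegDepSeq X)
    (hX : ∀ n, X n ∈ S.H) (hid : S.IdentDistribSeq X) {ε : ℝ} (hε : 0 < ε) {n : ℕ} (hn : 0 < n) :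
    S.capacity {ω | ε * n ≤ suffixMax (S.centeredTrunc X ω) n} ≤
      ENNReal.ofReal (∑ l ∈ Finset.range n,
        4 / ε ^ 2 * ((2 * (l : ℝ) + 1) * S.rexp fun ω => tailRamp l (X 0 ω)) * (n : ℝ)⁻¹) := by
  have hpos : ∀ i : ℕ, (0 : ℝ) ≤ i + 1 := fun i => by positivity
  have hmean : ∀ i : ℕ, S.rexp (fun ω => truncAt (i + 1) (X i ω)) =
      S.rexp fun ω => truncAt (i + 1) (X 0 ω) := fun i =>
    hid.rexp_eq hX zero_le_one (abs_truncAt_sub_le _) (abs_truncAt_le (hpos i)) i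
  obtain ⟨hF, hle⟩ := hneg.rexp_sq_suffixMax_le hX
    (Z := fun i x => truncAt (i + 1) x - S.rexp fun ω => truncAt (i + 1) (X 0 ω))
    (fun i x y => by rw [sub_sub_sub_cancel_right]; exact abs_truncAt_sub_le _ _ _)
    (K := fun i => (i + 1) + |S.rexp fun ω => truncAt (i + 1) (X 0 ω)|)
    (fun i x => (abs_sub _ _).trans (by gcongr; exact abs_truncAt_le (hpos i) x))
    (fun i x y h => by simp only; gcongr; exact truncAt_mono _ h)
    (fun i => by rw [rexp_sub_const (finExp_truncAt (hX i) (hpos i)), hmean, sub_self]) n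
  change S.FinExp (fun ω => suffixMax (S.centeredTrunc X ω) n ^ 2) at hF
  change S.rexp (fun ω => suffixMax (S.centeredTrunc X ω) n ^ 2) ≤ _ at hle
  set v : ℕ → ℝ := fun l => S.rexp fun ω => tailRamp l (X 0 ω) with hv
  have hvar : ∀ i ∈ Finset.range n, S.rexp (fun ω =>
      (truncAt (i + 1) (X i ω) - S.rexp fun ω => truncAt (i + 1) (X 0 ω)) ^ 2) ≤
        4 * ∑ l ∈ Finset.range n, (2 * (l : ℝ) + 1) * v l := by
    intro i hi
    rw [← hmean]
    refine (rexp_sub_sq_le (finExp_truncAt (hX i) (hpos i))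
      (finExp_sq_truncAt (hX i) (hpos i))).trans ?_
    refine mul_le_mul_of_nonneg_left ?_ (by norm_num)
    refine (rexp_sq_truncAt_le (hX i) (Finset.mem_range.1 hi)).trans_eq ?_
    exact Finset.sum_congr rfl fun l _ => by rw [hid.rexp_tailRamp hX]
  have hsum := hle.trans (Finset.sum_le_sum hvar)
  rw [Finset.sum_const, Finset.card_range, nsmul_eq_mul] at hsum
  have hn' : (0 : ℝ) < n := by exact_mod_cast hn
  refine (capacity_le_rexp (hF.smul ((ε * n) ^ 2)⁻¹) (fun ω => by positivity)
    fun ω hω => ?_).trans (ENNReal.ofReal_le_ofReal ?_)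
  · have hω' : ε * n ≤ suffixMax (S.centeredTrunc X ω) n := hω
    rw [inv_mul_eq_div, one_le_div (by positivity)]
    gcongr
  · rw [rexp_smul hF.1 (by positivity), ← Finset.sum_mul, ← Finset.mul_sum]
    refine (mul_le_mul_of_nonneg_left hsum (by positivity)).trans_eq ?_
    field_simp
    rfl

lemma tsum_rexp_tailRamp_ne_top {X : Ω → ℝ} (hX : X ∈ S.H)
    (hC : ∫⁻ t in Set.Ioi (0 : ℝ), S.capacity {ω | t ≤ |X ω|} < ⊤) :
    ∑' l : ℕ, ENNReal.ofReal (S.rexp fun ω => tailRamp l (X ω)) ≠ ⊤ := by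
  have h1 := tsum_mul_le_lintegral_Ioi (S.antitone_capacity_ge fun ω => |X ω|) one_pos
  simp only [ENNReal.ofReal_one, mul_one, one_mul] at h1
  -- The ramp at level `n + 2` lies below the indicator of `|x| ≥ n + 1`, the tail met by the
  -- integral comparison.
  rw [← ENNReal.summable.sum_add_tsum_nat_add' (k := 2)]
  refine ENNReal.add_ne_top.2 ⟨ENNReal.sum_ne_top.2 fun _ _ => ENNReal.ofReal_ne_top,
    ne_top_of_le_ne_top hC.ne (le_trans ?_ h1)⟩
  refine ENNReal.tsum_le_tsum fun n => (rexp_tailRamp_le_capacity hX _).trans <|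
    S.capacity_mono fun ω hω => ?_
  have hω' : ((n + 2 : ℕ) : ℝ) - 1 ≤ |X ω| := hω
  change (n : ℝ) + 1 ≤ |X ω|
  push_cast at hω'
  linarith

/-- Summability of the deviations of the maximal suffix sums along a geometric sequence. -/
lemma NegDepSeq.tsum_capacity_suffixMax_ne_top {X : ℕ → Ω → ℝ} (hneg : S.NegDepSeq X)
    (hX : ∀ n, X n ∈ S.H) (hid : S.IdentDistribSeq X)
    (hC : ∫⁻ t in Set.Ioi (0 : ℝ), S.capacity {ω | t ≤ |X 0 ω|} < ⊤)
    {ε : ℝ} (hε : 0 < ε) {c : ℝ} (hc : 1 < c) :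
    ∑' j : ℕ, S.capacity {ω | ε * (⌊c ^ j⌋₊ : ℕ) ≤
      suffixMax (S.centeredTrunc X ω) ⌊c ^ j⌋₊} ≠ ⊤ := by
  set v : ℕ → ℝ := fun l => S.rexp fun ω => tailRamp l (X 0 ω) with hv
  have hv0 : ∀ l, 0 ≤ v l := fun l =>
    rexp_nonneg (finExp_tailRamp (hX 0) l) fun _ => tailRamp_nonneg _ _
  have hci : 0 < 1 - c⁻¹ := sub_pos.2 (inv_lt_one_of_one_lt₀ hc)
  set u : ℕ → ℕ → ℝ := fun j l => if l < ⌊c ^ j⌋₊ then ((⌊c ^ j⌋₊ : ℕ) : ℝ)⁻¹ else 0 with hu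
  set b : ℕ → ℝ := fun l => 4 / ε ^ 2 * ((2 * (l : ℝ) + 1) * v l) with hb
  have hb0 : ∀ l, 0 ≤ b l := fun l => by
    have := hv0 l
    simp only [hb]; positivity
  have hpos : ∀ j, 0 < ⌊c ^ j⌋₊ := fun j => Nat.floor_pos.2 (one_le_pow₀ hc.le)
  have h1 : ∀ j, S.capacity {ω | ε * (⌊c ^ j⌋₊ : ℕ) ≤
      suffixMax (S.centeredTrunc X ω) ⌊c ^ j⌋₊} ≤
        ∑' l, ENNReal.ofReal (b l) * ENNReal.ofReal (u j l) := by
    intro j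
    refine (hneg.capacity_suffixMax_le hX hid hε (hpos j)).trans ?_
    rw [ENNReal.ofReal_sum_of_nonneg fun l _ => mul_nonneg (hb0 l) (by positivity)]
    refine le_trans (Finset.sum_le_sum fun l hl => ?_) (ENNReal.sum_le_tsum (Finset.range ⌊c ^ j⌋₊))
    rw [← ENNReal.ofReal_mul (hb0 l)]
    simp only [hu, if_pos (Finset.mem_range.1 hl)]
    exact le_rfl
  set G := ∑' j : ℕ, ENNReal.ofReal (c⁻¹ ^ j) with hG
  have hGtop : G ≠ ⊤ := (summable_geometric_of_lt_one (by positivity)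
    (inv_lt_one_of_one_lt₀ hc)).tsum_ofReal_ne_top
  -- With `l` fixed and `j` summed first, the weight `2 l + 1` cancels against the bound of order `1
  -- / (l + 1)`; only the tail series remains.
  have h2 : ∀ l, ENNReal.ofReal (b l) * ∑' j, ENNReal.ofReal (u j l) ≤
      ENNReal.ofReal (8 / ε ^ 2 * (1 - c⁻¹)⁻¹) * G * ENNReal.ofReal (v l) := by
    intro l
    have h3 : (2 * (l : ℝ) + 1) / (l + 1) ≤ 2 := by
      rw [div_le_iff₀ (by positivity)]; linarith
    have h4 : b l * ((1 - c⁻¹)⁻¹ / (l + 1)) ≤ 8 / ε ^ 2 * (1 - c⁻¹)⁻¹ * v l := calc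
      b l * ((1 - c⁻¹)⁻¹ / (l + 1))
      _ = 4 / ε ^ 2 * (1 - c⁻¹)⁻¹ * v l * ((2 * (l : ℝ) + 1) / (l + 1)) := by
          simp only [hb]; field_simp
      _ ≤ 4 / ε ^ 2 * (1 - c⁻¹)⁻¹ * v l * 2 := by
          have := hv0 l
          gcongr
      _ = 8 / ε ^ 2 * (1 - c⁻¹)⁻¹ * v l := by ring
    calc ENNReal.ofReal (b l) * ∑' j, ENNReal.ofReal (u j l)
        ≤ ENNReal.ofReal (b l) * (ENNReal.ofReal ((1 - c⁻¹)⁻¹ / (l + 1)) * G) := by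
          gcongr
          exact tsum_inv_floor_pow_le hc l
      _ = ENNReal.ofReal (b l * ((1 - c⁻¹)⁻¹ / (l + 1))) * G := by
          rw [ENNReal.ofReal_mul (hb0 l), mul_assoc]
      _ ≤ ENNReal.ofReal (8 / ε ^ 2 * (1 - c⁻¹)⁻¹ * v l) * G := by gcongr
      _ = ENNReal.ofReal (8 / ε ^ 2 * (1 - c⁻¹)⁻¹) * G * ENNReal.ofReal (v l) := by
          rw [ENNReal.ofReal_mul (by positivity), mul_right_comm]
  refine ne_top_of_le_ne_top ?_ (ENNReal.tsum_le_tsum h1)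
  rw [ENNReal.tsum_comm]
  simp only [ENNReal.tsum_mul_left]
  refine ne_top_of_le_ne_top ?_ (ENNReal.tsum_le_tsum h2)
  rw [ENNReal.tsum_mul_left]
  exact ENNReal.mul_ne_top (ENNReal.mul_ne_top ENNReal.ofReal_ne_top hGtop)
    (tsum_rexp_tailRamp_ne_top (hX 0) hC)

end SublinearSpace

/-! ### From geometric times to all times, for a fixed sequence. -/

lemma exists_floor_pow_bracket {c : ℝ} (hc : 1 < c) {n : ℕ} (hn : 1 ≤ n) :
    ∃ j, n < ⌊c ^ j⌋₊ ∧ ((⌊c ^ j⌋₊ : ℕ) : ℝ) ≤ c * (n + 1) := by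
  classical
  have hc0 : 0 < c := by linarith
  have hex : ∃ j, n < ⌊c ^ j⌋₊ := by
    obtain ⟨j, hj⟩ := pow_unbounded_of_one_lt ((n : ℝ) + 1) hc
    exact ⟨j, (Nat.le_floor (by push_cast; exact hj.le) : n + 1 ≤ _)⟩
  obtain ⟨J, hJ, hmin⟩ : ∃ J, n < ⌊c ^ J⌋₊ ∧ ∀ j < J, ¬ n < ⌊c ^ j⌋₊ :=
    ⟨Nat.find hex, Nat.find_spec hex, fun j => Nat.find_min hex⟩
  refine ⟨J, hJ, (Nat.floor_le (by positivity)).trans ?_⟩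
  rcases J with _ | J
  · simp at hJ; omega
  · have h1 : ⌊c ^ J⌋₊ ≤ n := not_lt.1 (hmin J (Nat.lt_succ_self J))
    have h2 : c ^ J < ⌊c ^ J⌋₊ + 1 := Nat.lt_floor_add_one _
    have h3 : ((⌊c ^ J⌋₊ : ℕ) : ℝ) ≤ n := by exact_mod_cast h1
    rw [pow_succ, mul_comm]
    gcongr
    linarith

/-- Write the sum up to `n` as the sum up to `m` minus the block over `[n, m)`, where `m` is the
next geometric time. The first is at most about `μ m`; the block has length of order `δ n` and is
bounded below through the suffix maximum of `-y`. -/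
lemma sum_range_le_of_suffixMax {x y a b : ℕ → ℝ} {μ ν δ : ℝ} (hδ0 : 0 < δ) (hδ1 : δ ≤ 1)
    (hxy : ∀ᶠ i in atTop, y i = x i) (ha : Tendsto a atTop (𝓝 μ)) (hb : Tendsto b atTop (𝓝 ν))
    (hz : ∀ᶠ j in atTop, suffixMax (fun i => y i - a i) ⌊(1 + δ) ^ j⌋₊ <
      δ * (⌊(1 + δ) ^ j⌋₊ : ℕ))
    (hz' : ∀ᶠ j in atTop, suffixMax (fun i => - y i - b i) ⌊(1 + δ) ^ j⌋₊ <
      δ * (⌊(1 + δ) ^ j⌋₊ : ℕ)) :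
    ∀ᶠ n : ℕ in atTop, (∑ i ∈ Finset.range n, x i) / n ≤
      μ + δ * (3 * |μ| + 3 * |ν| + 16) := by
  have hc : 1 < 1 + δ := by linarith
  obtain ⟨N₁, hN₁⟩ := eventually_atTop.1 hxy
  obtain ⟨J, hJ⟩ := eventually_atTop.1 (hz.and hz')
  obtain ⟨N₂, hN₂⟩ := eventually_atTop.1
    (hb.eventually_le_const ((le_abs_self ν).trans_lt (lt_add_one _)))
  obtain ⟨N₃, hN₃⟩ := eventually_atTop.1
    (ha.cesaro.eventually_le_const (lt_add_of_pos_right μ hδ0))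
  set D := |∑ i ∈ Finset.range N₁, x i - ∑ i ∈ Finset.range N₁, y i| with hD
  obtain ⟨N₄, hN₄⟩ := exists_nat_gt (1 / δ)
  obtain ⟨N₅, hN₅⟩ := exists_nat_gt (D / δ)
  filter_upwards [eventually_ge_atTop N₁, eventually_ge_atTop N₂, eventually_ge_atTop N₃,
    eventually_ge_atTop N₄, eventually_ge_atTop N₅, eventually_ge_atTop 1,
    eventually_ge_atTop ⌊(1 + δ) ^ J⌋₊] with n h1 h2 h3 h4 h5 hn h6
  obtain ⟨j, hj, hjc⟩ := exists_floor_pow_bracket hc hn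
  have hJj : J ≤ j := by
    by_contra! hlt
    have : ⌊(1 + δ) ^ j⌋₊ ≤ ⌊(1 + δ) ^ J⌋₊ :=
      Nat.floor_mono (pow_le_pow_right₀ hc.le hlt.le)
    omega
  obtain ⟨hs, hs'⟩ := hJ j hJj
  set m := ⌊(1 + δ) ^ j⌋₊
  have hn0 : (0 : ℝ) < n := by exact_mod_cast hn
  have hnm : (n : ℝ) ≤ m := by exact_mod_cast hj.le
  have hδn : 1 ≤ δ * n := by
    have : 1 / δ < n := hN₄.trans_le (by exact_mod_cast h4)
    rw [div_lt_iff₀ hδ0] at this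
    linarith
  have hDn : D ≤ δ * n := by
    have : D / δ < n := hN₅.trans_le (by exact_mod_cast h5)
    rw [div_lt_iff₀ hδ0] at this
    linarith
  -- From `m ≤ (1 + δ) (n + 1)` and `δ ≤ 1 ≤ δ n`.
  have hmn : (m : ℝ) - n ≤ 3 * (δ * n) := by nlinarith
  have hx : ∑ i ∈ Finset.range n, x i ≤ ∑ i ∈ Finset.range n, y i + δ * n := by
    rw [← Finset.sum_range_add_sum_Ico _ h1, ← Finset.sum_range_add_sum_Ico y h1,
      Finset.sum_congr rfl fun i hi => (hN₁ i (Finset.mem_Ico.1 hi).1).symm]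
    have := (le_abs_self _).trans (hD.symm.le.trans hDn)
    linarith
  have hy : ∑ i ∈ Finset.range n, y i + ∑ i ∈ Finset.Ico n m, y i = ∑ i ∈ Finset.range m, y i :=
    Finset.sum_range_add_sum_Ico y hj.le
  have hym := (sum_Ico_le_suffixMax (fun i => y i - a i) (Nat.zero_le m)).trans hs.le
  rw [Nat.Ico_zero_eq_range, Finset.sum_sub_distrib] at hym
  have hyI := (sum_Ico_le_suffixMax (fun i => - y i - b i) hj.le).trans hs'.le
  rw [Finset.sum_sub_distrib, Finset.sum_neg_distrib] at hyI
  have ham : ∑ i ∈ Finset.range m, a i ≤ (μ + δ) * m := by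
    have := hN₃ m (h3.trans hj.le)
    rwa [inv_mul_le_iff₀ (hn0.trans_le hnm), mul_comm] at this
  have hbI : ∑ i ∈ Finset.Ico n m, b i ≤ (m - n) * (|ν| + 1) := by
    refine (Finset.sum_le_card_nsmul _ _ (|ν| + 1) fun i hi =>
      hN₂ i (h2.trans (Finset.mem_Ico.1 hi).1)).trans_eq ?_
    rw [Nat.card_Ico, nsmul_eq_mul, Nat.cast_sub hj.le]
  rw [div_le_iff₀ hn0]
  have hδδ : δ * (δ * n) ≤ δ * n := by nlinarith
  have e1 : μ * m ≤ μ * n + |μ| * (3 * (δ * n)) := by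
    have : μ * (m - n) ≤ |μ| * (3 * (δ * n)) :=
      mul_le_mul (le_abs_self μ) hmn (by linarith) (abs_nonneg μ)
    linarith
  have e2 : (m - n) * (|ν| + 1) ≤ 3 * (δ * n) * (|ν| + 1) := by gcongr
  have e3 : δ * m ≤ 4 * (δ * n) := by nlinarith
  -- In units of `δ n` the constant `16` is `1` (changing `x` to `y`), `8` (`2 δ m` from the sum up
  -- to `m`), `4` (`δ m` from the block) and `3` (the `+ 1` beside `|ν|`).
  nlinarith

lemma limsup_average_le_of_suffixMax {x y a b : ℕ → ℝ} {μ ν : ℝ}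
    (hxy : ∀ᶠ i in atTop, y i = x i) (ha : Tendsto a atTop (𝓝 μ)) (hb : Tendsto b atTop (𝓝 ν))
    (hz : ∀ p : ℕ, ∀ᶠ j in atTop, suffixMax (fun i => y i - a i)
      ⌊(1 + 1 / ((p : ℝ) + 1)) ^ j⌋₊ < 1 / ((p : ℝ) + 1) * (⌊(1 + 1 / ((p : ℝ) + 1)) ^ j⌋₊ : ℕ))
    (hz' : ∀ p : ℕ, ∀ᶠ j in atTop, suffixMax (fun i => - y i - b i)
      ⌊(1 + 1 / ((p : ℝ) + 1)) ^ j⌋₊ < 1 / ((p : ℝ) + 1) * (⌊(1 + 1 / ((p : ℝ) + 1)) ^ j⌋₊ : ℕ)) :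
    limsup (fun n : ℕ => (((∑ i ∈ Finset.range n, x i) / (n : ℝ) : ℝ) : EReal)) atTop ≤ μ := by
  have h1 : Tendsto (fun p : ℕ => ((μ + 1 / ((p : ℝ) + 1) * (3 * |μ| + 3 * |ν| + 16) : ℝ) : EReal))
      atTop (𝓝 μ) := by
    refine (continuous_coe_real_ereal.tendsto μ).comp ?_
    simpa using (tendsto_one_div_add_atTop_nhds_zero_nat.mul_const
      (3 * |μ| + 3 * |ν| + 16)).const_add μ
  refine ge_of_tendsto' h1 fun p => limsup_le_of_le (h := ?_)
  have hδ1 : 1 / ((p : ℝ) + 1) ≤ 1 := by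
    rw [div_le_one (by positivity)]
    linarith [(p.cast_nonneg : (0 : ℝ) ≤ p)]
  filter_upwards [sum_range_le_of_suffixMax (by positivity) hδ1 hxy ha hb (hz p) (hz' p)] with n hn
  exact EReal.coe_le_coe_iff.2 hn

/-! ### Exceptional null sets and the strong law. -/

lemma LocLip.comp_neg {F : Type*} [NormedAddCommGroup F] {φ : F → ℝ} (h : LocLip φ) :
    LocLip fun x => φ (-x) := by
  obtain ⟨C, hC, m, hm⟩ := h
  refine ⟨C, hC, m, fun x y => (hm _ _).trans_eq ?_⟩
  rw [norm_neg, norm_neg, neg_sub_neg, norm_sub_rev]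

lemma measurable_suffixMax {Ω : Type*} [MeasurableSpace Ω] {Z : Ω → ℕ → ℝ}
    (h : ∀ i, Measurable fun ω => Z ω i) (n : ℕ) : Measurable fun ω => suffixMax (Z ω) n := by
  induction n with
  | zero => exact measurable_const
  | succ n ih => exact (ih.add (h n)).max measurable_const

namespace SublinearSpace

variable {Ω : Type*} [MeasurableSpace Ω] {S : SublinearSpace Ω}

lemma IdentDistribSeq.neg {X : ℕ → Ω → ℝ} (h : S.IdentDistribSeq X) :
    S.IdentDistribSeq fun n ω => - X n ω :=
  fun i _ hφ => h i _ hφ.comp_neg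

/-- Reflection exchanges the nondecreasing and the nonincreasing alternative. -/
lemma NegDepSeq.neg {X : ℕ → Ω → ℝ} (h : S.NegDepSeq X) : S.NegDepSeq fun n ω => - X n ω :=
  fun i φ₁ φ₂ h₁ h₂ a b c d e f => h i (fun v => φ₁ (-v)) (fun v => φ₂ (-v)) h₁.comp_neg
    h₂.comp_neg a b c d e <| f.symm.imp
      (fun g => ⟨fun _ _ hv => g.1 (neg_le_neg hv), fun _ _ hv => g.2 (neg_le_neg hv)⟩)
      (fun g => ⟨fun _ _ hv => g.1 (neg_le_neg hv), fun _ _ hv => g.2 (neg_le_neg hv)⟩)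

lemma finExp_of_tendsto {X : Ω → ℝ} (hX : X ∈ S.H)
    (h : Tendsto (fun c : ℝ => S.exp (fun ω => max (|X ω| - c) 0)) atTop (𝓝 0)) :
    S.FinExp X := by
  obtain ⟨c, hc⟩ := (h.eventually_lt_const EReal.zero_lt_top).exists
  have hm : (fun ω => max (|X ω| - c) 0) ∈ S.H :=
    S.comp_lip_mem (g := fun x => max (|x| - c) 0) zero_le_one (fun x y => by
      rw [one_mul]
      refine (abs_max_sub_max_le_abs _ _ _).trans ?_
      rw [sub_sub_sub_cancel_right]
      exact abs_abs_sub_abs_le x y) hX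
  have hF : S.FinExp fun ω => max (|X ω| - c) 0 :=
    ⟨hm, by simpa only [abs_of_nonneg (le_max_right _ (0 : ℝ))] using hc⟩
  exact .of_abs_le hX (hF.add (S.finExp_const c)) fun ω => by
    linarith [le_max_left (|X ω| - c) 0]

/-- The truncation error is at most `(|X| - b)^+`, whose expectation vanishes in the limit by
hypothesis. -/
lemma tendsto_rexp_truncAt {X : Ω → ℝ} (hX : X ∈ S.H)
    (h : Tendsto (fun c : ℝ => S.exp (fun ω => max (|X ω| - c) 0)) atTop (𝓝 0)) :
    Tendsto (fun i : ℕ => S.rexp fun ω => truncAt (i + 1) (X ω)) atTop (𝓝 (S.rexp X)) := by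
  have hF := finExp_of_tendsto hX h
  have hnat : Tendsto (fun i : ℕ => (i : ℝ) + 1) atTop atTop :=
    tendsto_atTop_add_const_right _ _ tendsto_natCast_atTop_atTop
  have h0 : Tendsto (fun i : ℕ => S.rexp (fun ω => max (|X ω| - (i + 1)) 0)) atTop (𝓝 0) :=
    (EReal.tendsto_toReal EReal.zero_ne_top EReal.zero_ne_bot).comp (h.comp hnat)
  refine tendsto_iff_dist_tendsto_zero.2 (squeeze_zero (fun _ => dist_nonneg) (fun i => ?_) h0)
  have hi : (0 : ℝ) ≤ i + 1 := by positivity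
  have hT := finExp_truncAt hX hi
  have hm : S.FinExp fun ω => max (|X ω| - (i + 1)) 0 := by
    refine .of_abs_le (S.comp_lip_mem (g := fun x => max (|x| - (i + 1)) 0) zero_le_one
      (fun x y => ?_) hX) hF.abs fun ω => ?_
    · rw [one_mul]
      refine (abs_max_sub_max_le_abs _ _ _).trans ?_
      rw [sub_sub_sub_cancel_right]
      exact abs_abs_sub_abs_le x y
    · rw [abs_of_nonneg (le_max_right _ _)]
      exact max_le (by linarith) (abs_nonneg _)
  have h1 := rexp_mono (hF.sub hT).abs hm fun ω => abs_sub_truncAt_le hi _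
  have h2 := rexp_sub_le hF hT
  have h3 := rexp_sub_le hT hF
  simp only [abs_sub_comm (truncAt _ _)] at h3
  rw [Real.dist_eq, abs_le]
  constructor <;> linarith

/-- Borel–Cantelli, which needs only countable sub-additivity of `V*` and `V* ≤ V` on events. -/
lemma outerMeasure_eventually_eq_zero {s : ℕ → Set Ω} (hs : ∀ n, MeasurableSet (s n))
    (h : ∑' n, S.capacity (s n) ≠ ⊤) :
    S.capacityOuterMeasure {ω | ¬ ∀ᶠ n in atTop, ω ∉ s n} = 0 := by
  have := measure_setOfPred_frequently_eq_zero (μ := S.capacityOuterMeasure)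
    (p := fun n ω => ω ∈ s n)
    (ne_top_of_le_ne_top h (ENNReal.tsum_le_tsum fun n => capacityOuterMeasure_le (hs n)))
  exact this

lemma measurable_centeredTrunc {X : ℕ → Ω → ℝ} (hX : ∀ n, X n ∈ S.H) (i : ℕ) :
    Measurable fun ω => S.centeredTrunc X ω i :=
  S.measurable_of_mem _
    ((finExp_truncAt (hX i) (by positivity)).sub (S.finExp_const _)).1

lemma NegDepSeq.outerMeasure_suffixMax_eq_zero {X : ℕ → Ω → ℝ} (hneg : S.NegDepSeq X)
    (hX : ∀ n, X n ∈ S.H) (hid : S.IdentDistribSeq X)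
    (hC : ∫⁻ t in Set.Ioi (0 : ℝ), S.capacity {ω | t ≤ |X 0 ω|} < ⊤)
    {ε : ℝ} (hε : 0 < ε) {c : ℝ} (hc : 1 < c) :
    S.capacityOuterMeasure {ω | ¬ ∀ᶠ j in atTop,
      suffixMax (S.centeredTrunc X ω) ⌊c ^ j⌋₊ < ε * (⌊c ^ j⌋₊ : ℕ)} = 0 := by
  have := outerMeasure_eventually_eq_zero (fun j => measurableSet_le measurable_const
    (measurable_suffixMax (measurable_centeredTrunc hX) _))
    (hneg.tsum_capacity_suffixMax_ne_top hX hid hC hε hc)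
  simpa only [Set.mem_ofPred_eq, not_le] using this

lemma outerMeasure_truncAt_ne_eq_zero {X : ℕ → Ω → ℝ} (hX : ∀ n, X n ∈ S.H)
    (hid : S.IdentDistribSeq X)
    (hC : ∫⁻ t in Set.Ioi (0 : ℝ), S.capacity {ω | t ≤ |X 0 ω|} < ⊤) :
    S.capacityOuterMeasure {ω | ¬ ∀ᶠ i : ℕ in atTop, truncAt (i + 1) (X i ω) = X i ω} = 0 := by
  have hsum : ∑' i : ℕ, S.capacity {ω | (i : ℝ) + 1 ≤ |X i ω|} ≠ ⊤ := by
    have h1 := tsum_rexp_tailRamp_ne_top (hX 0) hC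
    rw [← ENNReal.summable.sum_add_tsum_nat_add' (k := 1)] at h1
    refine ne_top_of_le_ne_top (ENNReal.add_ne_top.1 h1).2 (ENNReal.tsum_le_tsum fun i => ?_)
    rw [← hid.rexp_tailRamp hX _ i, Nat.cast_add, Nat.cast_one]
    exact capacity_le_rexp_tailRamp (hX i) _
  refine measure_mono_null (fun ω hω => ?_) (outerMeasure_eventually_eq_zero (fun i =>
    measurableSet_le measurable_const (S.measurable_of_mem _ (hX i)).abs) hsum)
  refine fun h => hω ?_
  filter_upwards [h] with i hi
  exact truncAt_eq_self (not_le.1 hi).le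

/-- The upper half of the strong law of large numbers for negatively dependent variables. -/
theorem NegDepSeq.outerMeasure_exp_lt_limsup {X : ℕ → Ω → ℝ} (hneg : S.NegDepSeq X)
    (hX : ∀ n, X n ∈ S.H) (hid : S.IdentDistribSeq X)
    (hC : ∫⁻ t in Set.Ioi (0 : ℝ), S.capacity {ω | t ≤ |X 0 ω|} < ⊤)
    (h : Tendsto (fun c : ℝ => S.exp (fun ω => max (|X 0 ω| - c) 0)) atTop (𝓝 0)) :
    S.capacityOuterMeasure
      {ω | S.exp (X 0) < limsup (fun n => partialAverage X n ω) atTop} = 0 := by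
  have hXn : ∀ n, (fun ω => - X n ω) ∈ S.H := fun n => S.H.neg_mem (hX n)
  have ha := tendsto_rexp_truncAt (hX 0) h
  have hb := tendsto_rexp_truncAt (hXn 0) (by simpa only [abs_neg] using h)
  have n1 := outerMeasure_truncAt_ne_eq_zero hX hid hC
  have n2 := fun p : ℕ => hneg.outerMeasure_suffixMax_eq_zero hX hid hC
    (ε := 1 / ((p : ℝ) + 1)) (by positivity) (c := 1 + 1 / ((p : ℝ) + 1))
    (lt_add_of_pos_right 1 (by positivity))
  have n3 := fun p : ℕ => hneg.neg.outerMeasure_suffixMax_eq_zero hXn hid.neg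
    (by simpa only [abs_neg] using hC)
    (ε := 1 / ((p : ℝ) + 1)) (by positivity) (c := 1 + 1 / ((p : ℝ) + 1))
    (lt_add_of_pos_right 1 (by positivity))
  refine measure_mono_null (fun ω hω => ?_)
    (measure_union_null n1 (measure_union_null (measure_iUnion_null n2) (measure_iUnion_null n3)))
  by_contra hcon
  simp only [Set.mem_union, Set.mem_iUnion, Set.mem_ofPred_eq, not_or, not_exists, not_not] at hcon
  obtain ⟨c1, c2, c3⟩ := hcon
  have hω' : S.exp (X 0) < limsup (fun n => partialAverage X n ω) atTop := hω
  rw [← (finExp_of_tendsto (hX 0) h).coe_rexp] at hω'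
  refine hω'.not_ge (limsup_average_le_of_suffixMax c1 ha hb c2 fun p => ?_)
  refine (c3 p).mono fun j hj => ?_
  -- Truncation is odd, so the centered truncations of `-X` are the terms `-y i - b i`.
  convert hj using 2
  ext i
  simp only [centeredTrunc]
  rw [truncAt_neg (by positivity)]

end SublinearSpace

theorem theorem5 {Ω : Type*} [MeasurableSpace Ω] (S : SublinearSpace Ω) (X : ℕ → Ω → ℝ)
    (hX : ∀ n, X n ∈ S.H) (hid : S.IdentDistribSeq X) :
    (S.NegDepSeq X →
      choquet S.capacity (fun ω => |X 0 ω|) < ⊤ →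
      Tendsto (fun c : ℝ => S.exp (fun ω => max (|X 0 ω| - c) 0)) atTop (𝓝 0) →
        S.outerCapacity
          ({ω | liminf (fun n => partialAverage X n ω) atTop < S.lowerExp (X 0)} ∪
            {ω | S.exp (X 0) < limsup (fun n => partialAverage X n ω) atTop}) = 0) ∧
    (S.IndepSeq X →
      ContinuousCapacity S.outerCapacity →
      S.CountablySubadditive →
      S.outerCapacity {ω | limsup (fun n => absPartialAverage X n ω) atTop = ⊤} < 1 →
        choquet S.capacity (fun ω => |X 0 ω|) < ⊤) := by
  refine ⟨fun hneg hC h => ?_, fun hind hcont hS hlt =>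
    SublinearSpace.choquet_lt_top_of_outerCapacity_lt_one hX hid hind hcont hS hlt⟩
  rw [S.choquet_lt_top_iff fun ω => abs_nonneg _] at hC
  rw [← S.capacityOuterMeasure_apply]
  refine measure_union_null ?_ (hneg.outerMeasure_exp_lt_limsup hX hid hC h)
  refine measure_mono_null (fun ω hω => ?_) (hneg.neg.outerMeasure_exp_lt_limsup
    (fun n => S.H.neg_mem (hX n)) hid.neg (by simpa only [abs_neg] using hC)
    (by simpa only [abs_neg] using h))
  have hω' : liminf (fun n => partialAverage X n ω) atTop < - S.exp (fun ω => - X 0 ω) := hω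
  change S.exp (fun ω => - X 0 ω) < limsup (fun n => partialAverage (fun n ω => - X n ω) n ω) atTop
  have e : (fun n => partialAverage (fun n ω => - X n ω) n ω) =
      -(fun n => partialAverage X n ω) := by
    ext n
    simp only [partialAverage, Pi.neg_apply, Finset.sum_neg_distrib, neg_div, EReal.coe_neg]
  rw [e, EReal.limsup_neg]
  rwa [← EReal.neg_lt_neg_iff, neg_neg]
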